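/- Multi-rate sequential (MRS) codes. Let $M_1,M_2,\dots$ be i.i.d. uniform bits. An MRS code consists of a random variable $Q$ with values in a measurable space $\mathcal Q$, known to both sender and receiver, a measurable encoder $(Q,\{M_i\})\mapsto X_j\in\{0,1\}$ for each $j\ge 1$ (which may look at the whole message), and a decoder which, from $Q$ and the first $n$ received symbols $Y_1^n\in\{0,1,e\}^n$, produces an estimate $\widetilde M_i(Q,Y_1^n)\in\{0,1\}$ for every $n$ and every $i\ge1$, measurably in $Q$. For $c\in[0,1]$, the erasure channel of capacity $c$ erases each $X_j$ independently with probability $1-c$: $Y_j=X_j$ with probability $c$ and $Y_j=e$ with probability $1-c$. The randomness $Q$, the message and the erasures are independent. A pair $(\rho,c)$ with $\rho\ge 0$ and $c\in[0,1]$ is $\epsilon$-admissible by a code if there is an $N_0$ such that, over the erasure channel of capacity $c$, $\mathbb P\{M_m\ne\widetilde M_m(Q,Y_1^N)\}\le\epsilon$ for all $N\ge N_0$ and all $1\le m\le N(\rho-\epsilon)$. A rate-capacity function is a function $r:[0,1]\to[0,\infty)$ that is non-decreasing, right continuous, and satisfies $r(c)=0$ for all $c\le\eta$ for some $\eta>0$.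 It is achievable if for every $\epsilon>0$ there is a code by which all pairs $(r(c),c)$, $c\in[0,1]$, are $\epsilon$-admissible. Theorem. A rate-capacity function $r$ is achievable if and only if $$\int_0^1\frac1c\,dr(c)\le 1,$$ where the integral is the Stieltjes integral over $(0,1]$ (a jump of $r$ at $c=1$ counts). -/

import Mathlib

open MeasureTheory ProbabilityTheory Set Topology
open scoped unitInterval NNReal ENNReal

universe u

noncomputable section

namespace MRS

/-- A message is an infinite bit sequence; `M i` is the bit `M_{i+1}` of the usual 1-based
numbering.  The same convention is used for the encoding symbols and the erasures. -/
abbrev Message : Type := ℕ → Bool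

/-- A received symbol: `some b` for the bit `b`, `none` for the erasure symbol `e`. -/
abbrev RecSymbol : Type := Option Bool

/-- A multi-rate sequential code.  `Q` with the law `law` is the common randomness of the sender
and the receiver.  The encoder sees the whole message; the decoder sees the first `n` received
symbols.  The measurability fields say only that the encoding symbols and the decoded bits
are random variables. -/
structure Code where
  Q : Type u
  [measurableSpaceQ : MeasurableSpace Q]
  law : Measure Q
  [isProbabilityMeasure_law : IsProbabilityMeasure law]
  enc : Q → Message → ℕ → Bool
  dec : Q → (n : ℕ) → (Fin n → RecSymbol) → ℕ → Bool
  measurable_enc : ∀ j : ℕ, Measurable fun p : Q × Message => enc p.1 p.2 j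
  measurable_dec : ∀ (n : ℕ) (y : Fin n → RecSymbol) (i : ℕ), Measurable fun q : Q => dec q n y i

attribute [instance] Code.measurableSpaceQ Code.isProbabilityMeasure_law

/-- The law of the message: i.i.d. fair bits. -/
def messageLaw : Measure Message :=
  Measure.infinitePi fun _ : ℕ => bernoulliMeasure true false ⟨1 / 2, by norm_num, by norm_num⟩

/-- The law of the erasure pattern (`true` means erased) of the erasure channel of capacity `c`:
i.i.d., each symbol is kept with probability `c` and erased with probability `1 - c`. -/
def erasureLaw (c : I) : Measure (ℕ → Bool) :=
  Measure.infinitePi fun _ : ℕ => bernoulliMeasure false true c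

/-- The output of the erasure channel with input `X` and erasure pattern `E`. -/
def channelOutput (X : ℕ → Bool) (E : ℕ → Bool) : ℕ → RecSymbol :=
  fun j => if E j = true then none else some (X j)

namespace Code

/-- The joint law of `(Q, M, E)`, which are independent, for the channel of capacity `c`. -/
def jointLaw (C : Code.{u}) (c : I) : Measure (C.Q × Message × (ℕ → Bool)) :=
  C.law.prod (messageLaw.prod (erasureLaw c))

/-- The estimate of the bit with index `i` from the first `N` received symbols. -/
def estimate (C : Code.{u}) (N i : ℕ) (ω : C.Q × Message × (ℕ → Bool)) : Bool :=
  C.dec ω.1 N (fun j : Fin N => channelOutput (C.enc ω.1 ω.2.1) ω.2.2 j) i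

/-- The probability that the bit with index `i` is decoded wrongly from the first `N` symbols
received through the erasure channel of capacity `c`. -/
def bitErrorProb (C : Code.{u}) (c : I) (N i : ℕ) : ℝ :=
  (C.jointLaw c).real {ω | ω.2.1 i ≠ C.estimate N i ω}

/-- The rate-capacity pair `(r, c)` is `ε`-admissible by the code `C`.  The bit with 1-based number
`m` has index `m - 1`. -/
def AdmissiblePair (C : Code.{u}) (ε : ℝ) (r : ℝ≥0) (c : I) : Prop :=
  ∃ N₀ : ℕ, ∀ N : ℕ, N₀ ≤ N → ∀ m : ℕ, 1 ≤ m → (m : ℝ) ≤ N * ((r : ℝ) - ε) →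
    C.bitErrorProb c N (m - 1) ≤ ε

end Code

/-- Rate-capacity functions `r : [0,1] → [0,∞)`. -/
structure RateCapacityFunction where
  toFun : I → ℝ≥0
  monotone' : Monotone toFun
  rightContinuous' : ∀ c : I, ContinuousWithinAt toFun (Ici c) c
  zero_near_zero' : ∃ η : ℝ, 0 < η ∧ ∀ c : I, (c : ℝ) ≤ η → toFun c = 0

namespace RateCapacityFunction

instance : CoeFun RateCapacityFunction fun _ => I → ℝ≥0 := ⟨toFun⟩

/-- `r` is `ε`-admissible by `C` if all the pairs `(r(c), c)` are. -/
def AdmissibleBy (r : RateCapacityFunction) (ε : ℝ) (C : Code.{u}) : Prop :=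
  ∀ c : I, C.AdmissiblePair ε (r c) c

/-- `r` is achievable if for every `ε > 0` it is `ε`-admissible by some code. -/
def Achievable (r : RateCapacityFunction) : Prop :=
  ∀ ε : ℝ, 0 < ε → ∃ C : Code.{u}, r.AdmissibleBy ε C

/-- The extension of `r` to the real line that is constant on `(-∞,0]` and on `[1,∞)`. -/
def stieltjes (r : RateCapacityFunction) : StieltjesFunction ℝ where
  toFun x := (r (projIcc 0 1 zero_le_one x) : ℝ)
  mono' _ _ h := NNReal.coe_le_coe.2 (r.monotone' (monotone_projIcc _ h))
  right_continuous' x := by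
    have h : ContinuousWithinAt (fun y : ℝ => r.toFun (projIcc 0 1 zero_le_one y)) (Ici x) x :=
      (r.rightContinuous' (projIcc 0 1 zero_le_one x)).comp
        continuous_projIcc.continuousWithinAt (fun _ hy => mem_Ici.2 (monotone_projIcc _ (mem_Ici.1 hy)))
    exact NNReal.continuous_coe.continuousAt.comp_continuousWithinAt h

/-- The Stieltjes integral `∫_0^1 (1/c) dr(c)`, as an element of `[0,∞]`; it is taken over `(0,1]`,
so a jump of `r` at `1` counts, while `r` has no mass at `0` because it vanishes near `0`. -/
def inverseCapacityIntegral (r : RateCapacityFunction) : ℝ≥0∞ :=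
  ∫⁻ c in Ioc (0 : ℝ) 1, ENNReal.ofReal (1 / c) ∂r.stieltjes.measure

end RateCapacityFunction

end MRS

end

/-!
Both directions discretize the capacity geometrically, `c_j = β ^ j` with `β → 1`, and compare
`∫ 1/c dr(c)` with the sum `∑_j (r(c_j) - r(c_{j+1})) / c_j` (`lintegral_Ioc_pow_le`,
`le_lintegral_Ioc_pow`).

**Converse.**  Let `G_c(m)` be the conditional entropy of the first `N` received symbols given the
first `m` message bits and the erasure pattern.  Because an erasure is independent of the past,
`G_c(m) / c` is a sum over `n < N` of the mean conditional entropy of the encoding symbol `n` given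
the `m` bits and what was received before it (`residual`, `capacity_mul_residual`).  Conditioning
reduces entropy and the erasure patterns of different capacities can be coupled monotonically, so
`G_c(m) / c` decreases in `c` (`residual_antitone`); it lies between `0` and `N log 2`.  By the
chain rule and Fano's inequality, each further reliably decoded bit lowers `G_c(m)` by nearly `log 2`
(`capacity_mul_residual_sub`).  Following `G_c(m) / c` from the smallest capacity and `m = 0` to the
largest capacity and all decoded bits gives
`∑_j (m_j - m_{j+1}) / c_j ≤ N (1 + o(1))`, where `m_j ≈ N r(c_j)` bits are decoded at capacity
`c_j` (`sum_guess_le`, `Code.sum_le_of_bitErrorProb_le`).  Entropies are taken over finitely many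
message bits, which are added modulo two to a reference message; the common randomness and the
reference message are averaged out at the end.

**Achievability.**  A layered code draws for each time `j` a layer `l` with probability `p l`, and
sends a uniformly random function of the first `⌊j s_l⌋` message bits.  At length `N` and rate `ρ`,
the symbols of a layer with `s_l ≥ ρ` whose prefix ends in `(x N, ρ N]` have frequency
`p l (ρ - x) / s_l`.  So if `c ∑_{s_l ≥ ρ} p l / s_l > 1`, then for every `x < ρ` more than
`(ρ - x) N` random equations about the bits between `x N` and `ρ N` are received, and a union bound
over the first wrong bit shows that the bits up to `(ρ - ε) N` are determined
(`measure_exists_consistent_le`, `lintegral_pow_card_usefulTimes_le`,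
`admissiblePair_layeredCode`).  For layers of decreasing capacities `k_l` this holds at every
capacity above `k_l`, with `ρ = s_l`, when `p l = s_l (1 / k_l - 1 / k_{l-1})`, the second term being absent
for the largest capacity; summation by parts turns the total probability into
`∑_l (s_l - s_{l+1}) / k_l`.  With `k_l = β ^ (l + 1)` and `s_l = β ^ 2 r(β ^ l)` every capacity
between `β ^ (l + 1)` and `β ^ l` is served at nearly its rate, and the total probability is at most
`β ∫ 1/c dr(c)`, hence at most one (`achievable_of_le_one`).
-/

namespace MRS

/-! ### Counting entropy on a finite sample space -/

section Entropy

variable {Ω α β : Type*} [Fintype Ω]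

open scoped Classical in
/-- The number of sample points at which `f` takes the same value as at `ω`. -/
noncomputable def fiberCard (f : Ω → α) (ω : Ω) : ℕ :=
  (Finset.univ.filter fun ω' => f ω' = f ω).card

/-- The sum over `ω` of the logarithm of the size of the fibre of `f` through `ω`.  For `ω` uniform
in `Ω`, the Shannon entropy of `f` is `log |Ω| - logFiberSum f / |Ω|`. -/
noncomputable def logFiberSum (f : Ω → α) : ℝ := ∑ ω, Real.log (fiberCard f ω)

/-- The conditional entropy `H(Z | W)` under the uniform law on `Ω`, multiplied by `|Ω|`. -/
noncomputable def condEnt (Z : Ω → β) (W : Ω → α) : ℝ :=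
  logFiberSum W - logFiberSum fun ω => (W ω, Z ω)

lemma fiberCard_pos (f : Ω → α) (ω : Ω) : 0 < fiberCard f ω :=
  Finset.card_pos.2 ⟨ω, by simp⟩

lemma fiberCard_congr {f : Ω → α} {g : Ω → β} (h : ∀ ω ω', f ω' = f ω ↔ g ω' = g ω) (ω : Ω) :
    fiberCard f ω = fiberCard g ω := by
  unfold fiberCard
  congr 1
  ext ω'
  simp [h ω ω']

lemma logFiberSum_congr {f : Ω → α} {g : Ω → β} (h : ∀ ω ω', f ω' = f ω ↔ g ω' = g ω) :
    logFiberSum f = logFiberSum g := by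
  unfold logFiberSum
  exact Finset.sum_congr rfl fun ω _ => by rw [fiberCard_congr h]

lemma condEnt_eq_sum (Z : Ω → β) (W : Ω → α) :
    condEnt Z W = ∑ ω, Real.log (fiberCard W ω / fiberCard (fun ω => (W ω, Z ω)) ω) := by
  unfold condEnt logFiberSum
  rw [← Finset.sum_sub_distrib]
  refine Finset.sum_congr rfl fun ω _ => ?_
  rw [Real.log_div] <;> exact_mod_cast (fiberCard_pos _ _).ne'

lemma condEnt_nonneg (Z : Ω → β) (W : Ω → α) : 0 ≤ condEnt Z W := by
  classical
  rw [condEnt_eq_sum]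
  refine Finset.sum_nonneg fun ω _ => Real.log_nonneg ?_
  rw [one_le_div (by exact_mod_cast fiberCard_pos _ _), Nat.cast_le]
  unfold fiberCard
  refine Finset.card_le_card fun ω' h => ?_
  simp only [Finset.mem_filter, Finset.mem_univ, true_and, Prod.mk.injEq] at h ⊢
  exact h.1

/-- **Gibbs' inequality**: the conditional entropy is at most the cross entropy of any conditional
law `q`. -/
lemma condEnt_le_crossEntropy [Fintype β] (Z : Ω → β) (W : Ω → α) (q : α → β → ℝ)
    (q_nonneg : ∀ w z, 0 ≤ q w z) (q_sum : ∀ w, ∑ z, q w z ≤ 1) (q_pos : ∀ ω, 0 < q (W ω) (Z ω)) :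
    condEnt Z W ≤ ∑ ω, -Real.log (q (W ω) (Z ω)) := by
  classical
  set V : Ω → α × β := fun ω => (W ω, Z ω) with hV
  have hVpos : ∀ ω, (0 : ℝ) < fiberCard V ω := fun ω => by exact_mod_cast fiberCard_pos _ _
  have hWpos : ∀ ω, (0 : ℝ) < fiberCard W ω := fun ω => by exact_mod_cast fiberCard_pos _ _
  have key : ∑ ω, (fiberCard W ω : ℝ) * q (W ω) (Z ω) / fiberCard V ω ≤ ∑ _ω : Ω, (1 : ℝ) := by
    have h1 : ∀ ω, (fiberCard W ω : ℝ) * q (W ω) (Z ω) / fiberCard V ω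
        = ∑ ω', if W ω = W ω' then q (W ω) (Z ω) / fiberCard V ω else 0 := by
      intro ω
      rw [← Finset.sum_filter, Finset.sum_const, nsmul_eq_mul, mul_div_assoc]
      congr 2
      unfold fiberCard
      congr 1
      ext ω'
      simp [eq_comm]
    simp_rw [h1]
    rw [Finset.sum_comm]
    refine Finset.sum_le_sum fun ω' _ => le_trans ?_ (q_sum (W ω'))
    rw [← Finset.sum_filter, ← Finset.sum_fiberwise _ Z]
    refine Finset.sum_le_sum fun z _ => ?_
    rw [Finset.filter_filter]
    have h2 : ∀ ω ∈ Finset.univ.filter (fun ω => W ω = W ω' ∧ Z ω = z),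
        q (W ω) (Z ω) / fiberCard V ω = q (W ω') z /
          (Finset.univ.filter (fun ω => W ω = W ω' ∧ Z ω = z)).card := by
      intro ω hω
      simp only [Finset.mem_filter, Finset.mem_univ, true_and] at hω
      rw [hω.1, hω.2]
      congr 2
      unfold fiberCard
      congr 1
      ext ω''
      simp [hV, hω.1, hω.2]
    rw [Finset.sum_congr rfl h2, Finset.sum_const, nsmul_eq_mul]
    rcases Nat.eq_zero_or_pos
      (Finset.univ.filter (fun ω => W ω = W ω' ∧ Z ω = z)).card with h | h
    · rw [h]; simpa using q_nonneg _ _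
    · rw [mul_div_cancel₀]
      exact_mod_cast h.ne'
  rw [condEnt_eq_sum, ← sub_nonpos, ← Finset.sum_sub_distrib]
  calc ∑ ω, (Real.log (fiberCard W ω / fiberCard V ω) - -Real.log (q (W ω) (Z ω)))
      ≤ ∑ ω, ((fiberCard W ω : ℝ) * q (W ω) (Z ω) / fiberCard V ω - 1) := by
        refine Finset.sum_le_sum fun ω _ => ?_
        rw [sub_neg_eq_add, ← Real.log_mul (div_pos (hWpos ω) (hVpos ω)).ne' (q_pos ω).ne']
        refine (Real.log_le_sub_one_of_pos
          (mul_pos (div_pos (hWpos ω) (hVpos ω)) (q_pos ω))).trans_eq ?_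
        ring
    _ ≤ 0 := by rw [Finset.sum_sub_distrib]; linarith

/-- Conditioning on less increases the conditional entropy. -/
lemma condEnt_le_condEnt_comp {γ : Type*} [Fintype β] (Z : Ω → β) (W : Ω → α) (f : α → γ) :
    condEnt Z W ≤ condEnt Z (f ∘ W) := by
  classical
  set n : γ → ℝ := fun c => (Finset.univ.filter fun ω => f (W ω) = c).card with hn
  set n' : γ → β → ℝ := fun c z => (Finset.univ.filter fun ω => f (W ω) = c ∧ Z ω = z).card with hn'
  have e1 : ∀ ω, (fiberCard (f ∘ W) ω : ℝ) = n (f (W ω)) := fun ω => by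
    simp only [fiberCard, hn, Function.comp]
  have e2 : ∀ ω, (fiberCard (fun ω => ((f ∘ W) ω, Z ω)) ω : ℝ) = n' (f (W ω)) (Z ω) := fun ω => by
    simp only [fiberCard, hn', Function.comp, Prod.mk.injEq]
  refine (condEnt_le_crossEntropy Z W (fun w z => n' (f w) z / n (f w))
    (fun w z => by positivity) (fun w => ?_) (fun ω => ?_)).trans_eq ?_
  · rw [← Finset.sum_div]
    refine div_le_one_of_le₀ (le_of_eq ?_) (by positivity)
    simp only [hn, hn']
    rw [← Nat.cast_sum]
    congr 1
    rw [Finset.card_eq_sum_card_fiberwise (f := Z) (t := Finset.univ) (by simp)]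
    simp [Finset.filter_filter]
  · rw [← e1, ← e2]
    exact div_pos (by exact_mod_cast fiberCard_pos _ _) (by exact_mod_cast fiberCard_pos _ _)
  · rw [condEnt_eq_sum]
    refine Finset.sum_congr rfl fun ω _ => ?_
    rw [← Real.log_inv, inv_div, ← e1, ← e2]

lemma condEnt_bool_le (Z : Ω → Bool) (W : Ω → α) :
    condEnt Z W ≤ Fintype.card Ω * Real.log 2 := by
  refine (condEnt_le_crossEntropy Z W (fun _ _ => 2⁻¹) (fun _ _ => by norm_num)
    (fun _ => by norm_num) (fun _ => by norm_num)).trans_eq ?_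
  simp

open scoped Classical in
/-- A linearized form of **Fano's inequality**: if a bit is guessed as `d W` then its conditional
entropy is at most the cross entropy of the law which trusts the guess with probability `1 - ε`. -/
lemma condEnt_bool_le_of_guess (Z : Ω → Bool) (W : Ω → α) (d : α → Bool) {ε : ℝ} (h0 : 0 < ε)
    (h1 : ε < 1) :
    condEnt Z W ≤ (∑ ω, if Z ω ≠ d (W ω) then 1 else 0) * (-Real.log ε)
      + Fintype.card Ω * (-Real.log (1 - ε)) := by
  refine (condEnt_le_crossEntropy Z W (fun w z => if z ≠ d w then ε else 1 - ε)
    (fun w z => by split_ifs <;> linarith) (fun w => ?_)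
    (fun ω => by split_ifs <;> linarith)).trans ?_
  · cases h : d w <;> simp
  · rw [Finset.sum_mul, ← nsmul_eq_mul, ← Finset.card_univ, ← Finset.sum_const,
      ← Finset.sum_add_distrib]
    refine Finset.sum_le_sum fun ω _ => ?_
    have : Real.log (1 - ε) ≤ 0 := Real.log_nonpos (by linarith) (by linarith)
    split_ifs <;> linarith

/-- If an involution of `Ω` preserves `W` and flips the bit `Z`, then `Z` is a fair bit
given `W`. -/
lemma condEnt_bool_eq_of_flip (Z : Ω → Bool) (W : Ω → α) (τ : Ω → Ω) (hτ : Function.Involutive τ)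
    (hW : ∀ ω, W (τ ω) = W ω) (hZ : ∀ ω, Z (τ ω) = !Z ω) :
    condEnt Z W = Fintype.card Ω * Real.log 2 := by
  classical
  have h : ∀ ω, fiberCard W ω = 2 * fiberCard (fun ω => (W ω, Z ω)) ω := by
    intro ω
    unfold fiberCard
    have hb : (Finset.univ.filter fun ω' => W ω' = W ω ∧ ¬ Z ω' = Z ω).card =
        (Finset.univ.filter fun ω' => W ω' = W ω ∧ Z ω' = Z ω).card := by
      refine Finset.card_bij (fun a _ => τ a) ?_ (fun a _ b _ hab => hτ.injective hab) ?_
      · intro a ha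
        simp only [Finset.mem_filter, Finset.mem_univ, true_and] at ha ⊢
        refine ⟨by rw [hW, ha.1], ?_⟩
        rw [hZ]
        have := ha.2
        cases h1 : Z a <;> cases h2 : Z ω <;> simp_all
      · intro b hb
        simp only [Finset.mem_filter, Finset.mem_univ, true_and] at hb
        refine ⟨τ b, ?_, hτ b⟩
        simp only [Finset.mem_filter, Finset.mem_univ, true_and]
        refine ⟨by rw [hW, hb.1], ?_⟩
        rw [hZ, hb.2]
        simp
    have := Finset.card_filter_add_card_filter_not (s := Finset.univ.filter fun ω' => W ω' = W ω)
      (fun ω' => Z ω' = Z ω)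
    rw [Finset.filter_filter, Finset.filter_filter] at this
    simp only [Prod.mk.injEq]
    omega
  rw [condEnt_eq_sum, ← nsmul_eq_mul, ← Finset.card_univ, ← Finset.sum_const]
  refine Finset.sum_congr rfl fun ω _ => ?_
  rw [h]
  push_cast
  rw [mul_div_cancel_right₀]
  exact_mod_cast (fiberCard_pos _ _).ne'

end Entropy

/-! ### The message law and the erasure law -/

section Laws

instance : IsProbabilityMeasure messageLaw := by unfold messageLaw; infer_instance

instance (c : I) : IsProbabilityMeasure (erasureLaw c) := by unfold erasureLaw; infer_instance

lemma bernoulliMeasure_map_xor (b : Bool) {p : I} (hp : σ p = p) :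
    (bernoulliMeasure true false p).map (xor b) = bernoulliMeasure true false p := by
  have hm : Measurable (xor b) := measurable_of_finite _
  rw [bernoulliMeasure_def, hp, Measure.map_add _ _ hm, Measure.map_smul, Measure.map_smul,
    Measure.map_dirac' hm, Measure.map_dirac' hm]
  cases b
  · rfl
  · exact add_comm _ _

/-- The message law is invariant under adding a fixed sequence modulo two. -/
lemma messageLaw_map_xor (t : ℕ → Bool) :
    messageLaw.map (fun M i => xor (t i) (M i)) = messageLaw := by
  unfold messageLaw
  rw [Measure.infinitePi_map_pi _ (f := fun i b => xor (t i) b) (fun _ => measurable_of_finite _)]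
  congr 1
  funext i
  exact bernoulliMeasure_map_xor _ (Subtype.ext (by norm_num [unitInterval.symm]))

/-- The erasure patterns for all capacities are coupled monotonically: symbol `j` is erased when a
uniform variable `U j` exceeds the capacity. -/
lemma erasureLaw_eq_map (c : I) :
    erasureLaw c = (Measure.infinitePi fun _ : ℕ => (volume : Measure I)).map
      (fun U j => decide (c < U j)) := by
  have hm : Measurable fun u : I => decide (c < u) :=
    measurable_to_bool (by convert! measurableSet_Ioi (a := c) using 1; ext; simp)
  rw [Measure.infinitePi_map_pi _ (f := fun _ u => decide (c < u)) (fun _ => hm)]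
  unfold erasureLaw
  congr 1
  funext _
  ext s hs
  classical
  rw [Measure.map_apply hm hs, bernoulliMeasure_apply _ hs]
  have h1 : (fun u : I => decide (c < u)) ⁻¹' s =
      {u | (c < u ∧ true ∈ s) ∨ (u ≤ c ∧ false ∈ s)} := by
    ext u
    by_cases h : c < u
    · simp [h, not_le.2 h]
    · simp [h, not_lt.1 h]
  rw [h1]
  have hc0 := c.2.1
  have hc1 := c.2.2
  have e1 : ENNReal.ofReal (c : ℝ) = (unitInterval.toNNReal c : ℝ≥0∞) := by
    rw [ENNReal.ofReal, ENNReal.coe_inj, ← NNReal.coe_inj, Real.coe_toNNReal _ hc0]; rfl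
  have e2 : ENNReal.ofReal (1 - (c : ℝ)) = (unitInterval.toNNReal (σ c) : ℝ≥0∞) := by
    rw [ENNReal.ofReal, ENNReal.coe_inj, ← NNReal.coe_inj, Real.coe_toNNReal _ (by linarith)]; rfl
  by_cases ht : true ∈ s <;> by_cases hf : false ∈ s <;> simp [ht, hf]
  · have : {u : I | c < u ∨ u ≤ c} = univ := by ext u; simpa using lt_or_ge c u
    rw [this]; simp
  · have := unitInterval.volume_Ioi c; rw [e2] at this; exact this.symm
  · have := unitInterval.volume_Iic c; rw [e1] at this; exact this.symm

/-- A function of a bit sequence that depends on finitely many bits only is measurable. -/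
lemma measurable_of_dependsOn_lt {γ : Type*} [MeasurableSpace γ] (n : ℕ) {f : (ℕ → Bool) → γ}
    (h : ∀ E E' : ℕ → Bool, (∀ k < n, E k = E' k) → f E = f E') : Measurable f := by
  have : f = (fun e : Fin n → Bool => f fun k => if hk : k < n then e ⟨k, hk⟩ else false) ∘
      fun E k => E k := by
    funext E
    exact h _ _ fun k hk => by simp [hk]
  rw [this]
  exact (measurable_of_finite _).comp (by fun_prop)

lemma integrable_of_dependsOn_lt (c : I) (n : ℕ) {f : (ℕ → Bool) → ℝ}
    (h : ∀ E E' : ℕ → Bool, (∀ k < n, E k = E' k) → f E = f E') :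
    Integrable f (erasureLaw c) := by
  have : f = (fun e : Fin n → Bool => f fun k => if hk : k < n then e ⟨k, hk⟩ else false) ∘
      fun E k => E k := by
    funext E
    exact h _ _ fun k hk => by simp [hk]
  rw [this]
  obtain ⟨B, hB⟩ := (Set.finite_range
    (fun e : Fin n → Bool => ‖f fun k => if hk : k < n then e ⟨k, hk⟩ else false‖)).bddAbove
  refine Integrable.of_bound (C := B)
    ((measurable_of_finite _).comp (by fun_prop)).aestronglyMeasurable ?_
  exact ae_of_all _ fun E => hB ⟨fun k : Fin n => E k, rfl⟩

/-- The erasure of symbol `n` is independent of the erasures of the earlier symbols. -/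
lemma integral_erased_else (c : I) (n : ℕ) {f : (ℕ → Bool) → ℝ}
    (h : ∀ E E' : ℕ → Bool, (∀ k < n, E k = E' k) → f E = f E') :
    ∫ E, (if E n = true then 0 else f E) ∂erasureLaw c = c * ∫ E, f E ∂erasureLaw c := by
  have hind : iIndepFun (fun (i : ℕ) (E : ℕ → Bool) => E i) (erasureLaw c) :=
    iIndepFun_infinitePi (X := fun _ b => b) fun _ => measurable_id
  have h2 := hind.indepFun_finset {n} (Finset.range n) (by simp) (fun i => measurable_pi_apply i)
  set φ : (({n} : Finset ℕ) → Bool) → ℝ := fun e => if e ⟨n, by simp⟩ = true then 0 else 1 with hφ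
  set ψ : ((Finset.range n) → Bool) → ℝ :=
    fun e => f fun k => if hk : k < n then e ⟨k, by simpa using hk⟩ else false with hψ
  have h3 := h2.comp (φ := φ) (ψ := ψ) (measurable_of_finite _) (measurable_of_finite _)
  have h4 := h3.integral_mul_eq_mul_integral
    ((measurable_of_finite φ).comp (by fun_prop)).aestronglyMeasurable
    ((measurable_of_finite ψ).comp (by fun_prop)).aestronglyMeasurable
  have e1 : (ψ ∘ fun (a : ℕ → Bool) (i : Finset.range n) => a i) = f := by
    funext E
    exact h _ _ fun k hk => by simp [hk]
  rw [e1] at h4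
  have e2 : ∫ E, (φ ∘ fun (a : ℕ → Bool) (i : ({n} : Finset ℕ)) => a i) E ∂erasureLaw c = c := by
    have : (φ ∘ fun (a : ℕ → Bool) (i : ({n} : Finset ℕ)) => a i) =
        (fun b : Bool => if b = true then (0 : ℝ) else 1) ∘ fun E : ℕ → Bool => E n := by
      funext E; rfl
    rw [this]
    have hmap := Measure.infinitePi_map_eval (fun _ : ℕ => bernoulliMeasure false true c) n
    have := integral_map (μ := erasureLaw c) (φ := fun E : ℕ → Bool => E n)
      (f := fun b : Bool => if b = true then (0 : ℝ) else 1) (measurable_pi_apply n).aemeasurable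
      (measurable_of_finite _).aestronglyMeasurable
    rw [Function.comp_def, ← this]
    unfold erasureLaw
    rw [hmap, integral_bernoulliMeasure]
    simp
  rw [e2] at h4
  rw [← h4]
  congr 1
  funext E
  simp [hφ]

end Laws

/-! ### Received information and its dependence on the capacity -/

section Observation

variable {Ω : Type*} (B X : Ω → ℕ → Bool)

/-- The first `m` message bits together with the first `n` received symbols, when the message bits
are `B ω`, the encoding symbols are `X ω` and the erasure pattern is `E`.  The sequences are padded
so that the type does not depend on `m` and `n`. -/
def observation (m n : ℕ) (E : ℕ → Bool) (ω : Ω) : (ℕ → Bool) × (ℕ → RecSymbol) :=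
  (fun i => if i < m then B ω i else false,
    fun k => if k < n then channelOutput (X ω) E k else none)

lemma observation_eq_iff (m n : ℕ) (E : ℕ → Bool) (ω ω' : Ω) :
    observation B X m n E ω' = observation B X m n E ω ↔
      (∀ i < m, B ω' i = B ω i) ∧ ∀ k < n, E k = false → X ω' k = X ω k := by
  simp only [observation, channelOutput, Prod.mk.injEq, funext_iff]
  refine and_congr (forall_congr' fun i => ?_) (forall_congr' fun k => ?_)
  · by_cases h : i < m <;> simp [h]
  · by_cases h : k < n <;> by_cases h' : E k = true <;> simp [h, h']

lemma measurableSet_guess_ne (N i : ℕ) (d : (Fin N → RecSymbol) → ℕ → Bool) (ω : Ω) :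
    MeasurableSet {E : ℕ → Bool | B ω i ≠ d (fun j => channelOutput (X ω) E j) i} := by
  refine Measurable.setOf (measurable_of_dependsOn_lt N fun E E' h => ?_)
  have : (fun j : Fin N => channelOutput (X ω) E j) = fun j : Fin N => channelOutput (X ω) E' j := by
    funext j
    simp [channelOutput, h j j.2]
  rw [this]

variable [Fintype Ω]

/-- The conditional entropy, times `|Ω|`, of the encoding symbol `n` given the first `m` message
bits and the symbols received earlier. -/
noncomputable def symbolEnt (m n : ℕ) (E : ℕ → Bool) : ℝ :=
  condEnt (fun ω => X ω n) (observation B X m n E)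

lemma symbolEnt_congr (m n : ℕ) (E E' : ℕ → Bool) (h : ∀ k < n, E k = E' k) :
    symbolEnt B X m n E = symbolEnt B X m n E' := by
  have : observation B X m n E = observation B X m n E' := by
    funext ω
    simp only [observation, channelOutput, Prod.mk.injEq, true_and]
    funext k
    by_cases hk : k < n
    · simp [hk, h k hk]
    · simp [hk]
  unfold symbolEnt
  rw [this]

/-- The more symbols are erased, the larger is the conditional entropy of the next symbol. -/
lemma symbolEnt_mono (m n : ℕ) {E E' : ℕ → Bool} (h : ∀ k, E k = true → E' k = true) :
    symbolEnt B X m n E ≤ symbolEnt B X m n E' := by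
  have : observation B X m n E' =
      (fun w => (w.1, fun k => if E' k = true then none else w.2 k)) ∘ observation B X m n E := by
    funext ω
    simp only [observation, channelOutput, Prod.mk.injEq, true_and, Function.comp]
    funext k
    by_cases hk : k < n <;> by_cases h1 : E k = true <;> by_cases h2 : E' k = true <;>
      simp_all
  unfold symbolEnt
  rw [this]
  exact condEnt_le_condEnt_comp _ _ _

lemma logFiberSum_observation_succ (m n : ℕ) (E : ℕ → Bool) :
    logFiberSum (observation B X m n E) - logFiberSum (observation B X m (n + 1) E) =
      if E n = true then 0 else symbolEnt B X m n E := by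
  split_ifs with h
  · rw [sub_eq_zero]
    refine logFiberSum_congr fun ω ω' => ?_
    rw [observation_eq_iff, observation_eq_iff]
    refine and_congr_right fun _ => ⟨fun h' k hk hE => ?_, fun h' k hk => h' k (by omega)⟩
    rcases Nat.lt_succ_iff_lt_or_eq.1 hk with hk | rfl
    · exact h' k hk hE
    · simp [h] at hE
  · unfold symbolEnt condEnt
    congr 1
    refine logFiberSum_congr fun ω ω' => ?_
    simp only [Prod.mk.injEq]
    rw [observation_eq_iff, observation_eq_iff, and_assoc]
    refine and_congr_right fun _ => ⟨fun h' => ⟨fun k hk => h' k (by omega), h' n (by omega)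
      (by simpa using h)⟩, fun h' k hk hE => ?_⟩
    rcases Nat.lt_succ_iff_lt_or_eq.1 hk with hk | rfl
    · exact h'.1 k hk hE
    · exact h'.2

/-- The chain rule over the received symbols. -/
lemma sum_symbolEnt (m n : ℕ) (E : ℕ → Bool) :
    ∑ k ∈ Finset.range n, (if E k = true then 0 else symbolEnt B X m k E) =
      logFiberSum (observation B X m 0 E) - logFiberSum (observation B X m n E) := by
  simp_rw [← logFiberSum_observation_succ]
  exact Finset.sum_range_sub' (fun n => logFiberSum (observation B X m n E)) n

lemma logFiberSum_observation_bit (m n : ℕ) (E : ℕ → Bool) :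
    logFiberSum (observation B X m n E) - logFiberSum (observation B X (m + 1) n E) =
      condEnt (fun ω => B ω m) (observation B X m n E) := by
  unfold condEnt
  congr 1
  refine logFiberSum_congr fun ω ω' => ?_
  simp only [Prod.mk.injEq]
  rw [observation_eq_iff, observation_eq_iff]
  constructor
  · exact fun h' => ⟨⟨fun k hk => h'.1 k (by omega), h'.2⟩, h'.1 m (by omega)⟩
  · rintro ⟨⟨h1, h2⟩, h3⟩
    refine ⟨fun k hk => ?_, h2⟩
    rcases Nat.lt_succ_iff_lt_or_eq.1 hk with hk | rfl
    · exact h1 k hk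
    · exact h3

/-- The residual information: the entropy of the first `N` received symbols given the first `m`
message bits and the erasure pattern, times `|Ω|` and divided by the capacity `c`.  By the chain
rule it is a sum of conditional entropies of encoding symbols, which makes sense for `c = 0` too. -/
noncomputable def residual (N : ℕ) (c : I) (m : ℕ) : ℝ :=
  ∑ n ∈ Finset.range N, ∫ E, symbolEnt B X m n E ∂erasureLaw c

lemma residual_nonneg (N : ℕ) (c : I) (m : ℕ) : 0 ≤ residual B X N c m :=
  Finset.sum_nonneg fun _ _ => integral_nonneg fun _ => condEnt_nonneg _ _

lemma residual_le (N : ℕ) (c : I) (m : ℕ) :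
    residual B X N c m ≤ N * (Fintype.card Ω * Real.log 2) := by
  unfold residual
  rw [← nsmul_eq_mul]
  nth_rewrite 2 [← Finset.card_range N]
  refine Finset.sum_le_card_nsmul _ _ _ fun n _ => ?_
  calc ∫ E, symbolEnt B X m n E ∂erasureLaw c
      ≤ ∫ _E, Fintype.card Ω * Real.log 2 ∂erasureLaw c :=
        integral_mono (integrable_of_dependsOn_lt c n (symbolEnt_congr B X m n))
          (integrable_const _) fun E => condEnt_bool_le _ _
    _ = _ := by simp

/-- A form of Han's inequality: the entropy received per unit of capacity decreases with the
capacity. -/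
lemma residual_antitone (N : ℕ) (m : ℕ) : Antitone fun c => residual B X N c m := by
  intro c c' hc
  refine Finset.sum_le_sum fun n _ => ?_
  have hm : ∀ c : I, Measurable fun (U : ℕ → I) j => decide (c < U j) := fun c =>
    measurable_pi_lambda _ fun j => (measurable_to_bool (f := fun u : I => decide (c < u))
      (by convert! measurableSet_Ioi (a := c) using 1; ext; simp)).comp (measurable_pi_apply j)
  have hs := measurable_of_dependsOn_lt n (symbolEnt_congr B X m n)
  have hi := fun c => integrable_of_dependsOn_lt c n (symbolEnt_congr B X m n)
  simp_rw [erasureLaw_eq_map] at hi ⊢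
  rw [integral_map (hm _).aemeasurable hs.aestronglyMeasurable,
    integral_map (hm _).aemeasurable hs.aestronglyMeasurable]
  refine integral_mono ((hi c').comp_measurable (hm c')) ((hi c).comp_measurable (hm c)) fun U => ?_
  exact symbolEnt_mono B X m n fun k hk => by simpa using hc.trans_lt (by simpa using hk)

lemma capacity_mul_residual (N : ℕ) (c : I) (m : ℕ) :
    c * residual B X N c m = ∫ E, (logFiberSum (observation B X m 0 E) -
      logFiberSum (observation B X m N E)) ∂erasureLaw c := by
  unfold residual
  rw [Finset.mul_sum]
  simp_rw [← sum_symbolEnt]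
  rw [integral_finsetSum]
  · exact Finset.sum_congr rfl fun n _ =>
      (integral_erased_else c n (symbolEnt_congr B X m n)).symm
  · intro n _
    refine integrable_of_dependsOn_lt c (n + 1) fun E E' h => ?_
    rw [h n (by omega), symbolEnt_congr B X m n E E' fun k hk => h k (by omega)]

/-- A message bit that is uniform given the earlier ones, and that can be guessed from the received
symbols, lowers the residual information. -/
lemma capacity_mul_residual_sub (N : ℕ) (c : I) (m : ℕ) (d : (Fin N → RecSymbol) → ℕ → Bool)
    (τ : Ω → Ω) (hτ : Function.Involutive τ) (hlt : ∀ ω, ∀ i < m, B (τ ω) i = B ω i)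
    (hm : ∀ ω, B (τ ω) m = !B ω m) {ε : ℝ} (h0 : 0 < ε) (h1 : ε < 1) :
    Fintype.card Ω * (Real.log 2 + Real.log (1 - ε)) + Real.log ε * ∑ ω, (erasureLaw c).real
        {E | B ω m ≠ d (fun j => channelOutput (X ω) E j) m} ≤
      c * (residual B X N c m - residual B X N c (m + 1)) := by
  have hint : ∀ m n, Integrable (fun E => logFiberSum (observation B X m 0 E) -
      logFiberSum (observation B X m n E)) (erasureLaw c) := by
    intro m n
    simp_rw [← sum_symbolEnt]
    refine integrable_finsetSum _ fun n _ => ?_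
    refine integrable_of_dependsOn_lt c (n + 1) fun E E' h => ?_
    rw [h n (by omega), symbolEnt_congr B X m n E E' fun k hk => h k (by omega)]
  have hind : ∀ ω, Integrable ({E | B ω m ≠ d (fun j => channelOutput (X ω) E j) m}.indicator
      (1 : (ℕ → Bool) → ℝ)) (erasureLaw c) := fun ω =>
    (integrable_const (1 : ℝ)).indicator (measurableSet_guess_ne B X N m d ω)
  rw [mul_sub, capacity_mul_residual, capacity_mul_residual, ← integral_sub (hint _ _) (hint _ _)]
  have e1 : ∑ ω, (erasureLaw c).real {E | B ω m ≠ d (fun j => channelOutput (X ω) E j) m} =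
      ∫ E, ∑ ω, {E | B ω m ≠ d (fun j => channelOutput (X ω) E j) m}.indicator
        (1 : (ℕ → Bool) → ℝ) E ∂erasureLaw c := by
    rw [integral_finsetSum _ fun ω _ => hind ω]
    exact Finset.sum_congr rfl fun ω _ =>
      (integral_indicator_one (measurableSet_guess_ne B X N m d ω)).symm
  have e2 : ∀ a : ℝ, a + Real.log ε * ∑ ω,
      (erasureLaw c).real {E | B ω m ≠ d (fun j => channelOutput (X ω) E j) m} =
      ∫ E, (a + Real.log ε * ∑ ω, {E | B ω m ≠ d (fun j => channelOutput (X ω) E j) m}.indicator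
        (1 : (ℕ → Bool) → ℝ) E) ∂erasureLaw c := by
    intro a
    rw [integral_add (integrable_const _) ((integrable_finsetSum _ fun ω _ => hind ω).const_mul _),
      integral_const_mul, ← e1]
    simp
  rw [e2]
  refine integral_mono ((integrable_const _).add
    ((integrable_finsetSum _ fun ω _ => hind ω).const_mul _)) ((hint _ _).sub (hint _ _)) fun E => ?_
  have a1 := logFiberSum_observation_bit B X m 0 E
  have a2 := logFiberSum_observation_bit B X m N E
  rw [condEnt_bool_eq_of_flip _ _ τ hτ _ fun ω => hm ω] at a1
  swap
  · intro ω
    rw [observation_eq_iff]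
    exact ⟨hlt ω, by simp⟩
  have a3 := condEnt_bool_le_of_guess (fun ω => B ω m) (observation B X m N E)
    (fun w => d (fun j => w.2 j) m) h0 h1
  have a4 : ∀ ω, {E | B ω m ≠ d (fun j => channelOutput (X ω) E j) m}.indicator
      (1 : (ℕ → Bool) → ℝ) E =
      if B ω m ≠ d (fun j : Fin N => (observation B X m N E ω).2 j) m then (1 : ℝ) else 0 := by
    intro ω
    simp [observation, Set.indicator_apply]
  simp_rw [a4]
  rw [← a2] at a3
  set S := ∑ ω, if B ω m ≠ d (fun j : Fin N => (observation B X m N E ω).2 j) m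
      then (1 : ℝ) else 0
  set n : ℝ := (Fintype.card Ω : ℝ)
  linarith

end Observation

/-! ### The converse for finitely many capacities -/

section Converse

/-- The residual information telescopes over a decreasing sequence of capacities: passing to a
larger capacity does not increase it, and every decoded bit lowers it. -/
lemma sum_guess_le {Ω : Type*} [Fintype Ω] (B X : Ω → ℕ → Bool) (N K : ℕ)
    (d : (Fin N → RecSymbol) → ℕ → Bool)
    (hflip : ∀ i < K, ∃ τ : Ω → Ω, Function.Involutive τ ∧ (∀ ω, ∀ k < i, B (τ ω) k = B ω k) ∧
      ∀ ω, B (τ ω) i = !B ω i)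
    (c : ℕ → I) (c_anti : Antitone c) (c_pos : ∀ j, 0 < (c j : ℝ)) (m : ℕ → ℕ) (m_anti : Antitone m)
    (m_le : m 0 ≤ K) {ε : ℝ} (h0 : 0 < ε) (h1 : ε < 1) (J : ℕ) :
    ∑ j ∈ Finset.range J, (c j : ℝ)⁻¹ * ∑ i ∈ Finset.Ico (m (j + 1)) (m j),
      (Fintype.card Ω * (Real.log 2 + Real.log (1 - ε)) + Real.log ε * ∑ ω, (erasureLaw (c j)).real
        {E | B ω i ≠ d (fun k => channelOutput (X ω) E k) i}) ≤
      N * (Fintype.card Ω * Real.log 2) := by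
  suffices h : ∑ j ∈ Finset.range J, (c j : ℝ)⁻¹ * ∑ i ∈ Finset.Ico (m (j + 1)) (m j),
      (Fintype.card Ω * (Real.log 2 + Real.log (1 - ε)) + Real.log ε * ∑ ω, (erasureLaw (c j)).real
        {E | B ω i ≠ d (fun k => channelOutput (X ω) E k) i}) ≤ residual B X N (c J) (m J) from
    h.trans (residual_le _ _ _ _ _)
  induction J with
  | zero => simpa using residual_nonneg _ _ _ _ _
  | succ J ih =>
    rw [Finset.sum_range_succ]
    have hstep : (c J : ℝ)⁻¹ * ∑ i ∈ Finset.Ico (m (J + 1)) (m J),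
        (Fintype.card Ω * (Real.log 2 + Real.log (1 - ε)) + Real.log ε * ∑ ω,
        (erasureLaw (c J)).real {E | B ω i ≠ d (fun k => channelOutput (X ω) E k) i}) ≤
        residual B X N (c J) (m (J + 1)) - residual B X N (c J) (m J) := by
      rw [inv_mul_le_iff₀ (c_pos J)]
      have htel := Finset.sum_Ico_sub (fun i => -residual B X N (c J) i) (m_anti (Nat.le_succ J))
      have : residual B X N (c J) (m (J + 1)) - residual B X N (c J) (m J) =
          ∑ i ∈ Finset.Ico (m (J + 1)) (m J),
            (residual B X N (c J) i - residual B X N (c J) (i + 1)) := by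
        rw [show residual B X N (c J) (m (J + 1)) - residual B X N (c J) (m J) =
          -residual B X N (c J) (m J) - -residual B X N (c J) (m (J + 1)) by ring, ← htel]
        exact Finset.sum_congr rfl fun i _ => by ring
      rw [this, Finset.mul_sum]
      refine Finset.sum_le_sum fun i hi => ?_
      obtain ⟨τ, hτ, hlt, hi'⟩ := hflip i
        (((Finset.mem_Ico.1 hi).2.trans_le (m_anti (Nat.zero_le J))).trans_le m_le)
      exact capacity_mul_residual_sub B X N (c J) i d τ hτ hlt hi' h0 h1
    have := residual_antitone B X N (m (J + 1)) (c_anti (Nat.le_succ J))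
    simp only at this
    linarith

namespace Code

variable (C : Code.{u})

/-- The probability, over the erasures only, that the bit with index `i` is decoded wrongly. -/
noncomputable def condErrorProb (c : I) (N i : ℕ) (p : C.Q × Message) : ℝ :=
  (erasureLaw c).real {E | p.2 i ≠ C.dec p.1 N (fun j => channelOutput (C.enc p.1 p.2) E j) i}

lemma measurable_estimate (N i : ℕ) : Measurable (C.estimate N i) := by
  have h1 : Measurable fun x : C.Q × ((Fin N → Bool) × (Fin N → Bool)) =>
      C.dec x.1 N (fun j => if x.2.1 j = true then none else some (x.2.2 j)) i :=
    measurable_from_prod_countable_left fun y =>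
      C.measurable_dec N (fun j => if y.1 j = true then none else some (y.2 j)) i
  have h2 : Measurable fun ω : C.Q × Message × (ℕ → Bool) =>
      (ω.1, ((fun j : Fin N => ω.2.2 j), fun j : Fin N => C.enc ω.1 ω.2.1 j)) := by
    refine measurable_fst.prodMk (Measurable.prodMk (by fun_prop) ?_)
    exact measurable_pi_lambda _ fun j => (C.measurable_enc j).comp
      (measurable_fst.prodMk (measurable_fst.comp measurable_snd))
  exact h1.comp h2

lemma measurableSet_error (N i : ℕ) :
    MeasurableSet {ω : C.Q × Message × (ℕ → Bool) | ω.2.1 i ≠ C.estimate N i ω} :=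
  (measurableSet_eq_fun (by fun_prop) (C.measurable_estimate N i)).compl

lemma measurable_condErrorProb (c : I) (N i : ℕ) : Measurable (C.condErrorProb c N i) := by
  have h := (MeasurableEquiv.prodAssoc (α := C.Q) (β := Message) (γ := ℕ → Bool)).measurable
    (C.measurableSet_error N i)
  exact (measurable_measure_prodMk_left (ν := erasureLaw c) h).ennreal_toReal

lemma bitErrorProb_eq_integral (c : I) (N i : ℕ) :
    C.bitErrorProb c N i = ∫ p, C.condErrorProb c N i p ∂C.law.prod messageLaw := by
  have hp := measurePreserving_prodAssoc C.law messageLaw (erasureLaw c)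
  have hs := C.measurableSet_error N i
  have h := hp.measurable hs
  unfold bitErrorProb jointLaw
  rw [measureReal_def, ← hp.measure_preimage hs.nullMeasurableSet, Measure.prod_apply h,
    ← integral_toReal (measurable_measure_prodMk_left h).aemeasurable
      (ae_of_all _ fun _ => measure_lt_top _ _)]
  rfl

lemma integrable_condErrorProb (c : I) (N i : ℕ) :
    Integrable (C.condErrorProb c N i) (C.law.prod messageLaw) :=
  Integrable.of_bound (C.measurable_condErrorProb c N i).aestronglyMeasurable 1
    (ae_of_all _ fun p => by
      unfold condErrorProb
      rw [Real.norm_of_nonneg measureReal_nonneg]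
      exact measureReal_le_one)

lemma measurePreserving_xor (t : ℕ → Bool) :
    MeasurePreserving (fun p : C.Q × Message => (p.1, fun i => xor (t i) (p.2 i)))
      (C.law.prod messageLaw) (C.law.prod messageLaw) :=
  (MeasurePreserving.id _).prod ⟨measurable_pi_lambda _ fun i =>
    (measurable_of_finite (xor (t i))).comp (measurable_pi_apply i), messageLaw_map_xor t⟩

/-- The finite form of the converse: for a decreasing sequence of capacities `c j` such that the
first `m j` bits are decoded reliably at capacity `c j`. -/
lemma sum_le_of_bitErrorProb_le (N : ℕ) (c : ℕ → I) (c_anti : Antitone c)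
    (c_pos : ∀ j, 0 < (c j : ℝ)) (m : ℕ → ℕ) (m_anti : Antitone m) {ε : ℝ} (h0 : 0 < ε)
    (h1 : ε < 1) (J : ℕ) (herr : ∀ j < J, ∀ i < m j, C.bitErrorProb (c j) N i ≤ ε) :
    (∑ j ∈ Finset.range J, (c j : ℝ)⁻¹ * ((m j : ℝ) - m (j + 1))) *
      (Real.log 2 + Real.log (1 - ε) + ε * Real.log ε) ≤ N * Real.log 2 := by
  set K := m 0 with hK
  let t : (Fin K → Bool) → ℕ → Bool := fun ω i => if h : i < K then ω ⟨i, h⟩ else false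
  let B : Message → (Fin K → Bool) → ℕ → Bool := fun M ω i => xor (t ω i) (M i)
  have hflip : ∀ M, ∀ i < K, ∃ τ : (Fin K → Bool) → (Fin K → Bool), Function.Involutive τ ∧
      (∀ ω, ∀ k < i, B M (τ ω) k = B M ω k) ∧ ∀ ω, B M (τ ω) i = !B M ω i := by
    intro M i hi
    refine ⟨fun ω => Function.update ω ⟨i, hi⟩ (!ω ⟨i, hi⟩), fun ω => by simp, fun ω k hk => ?_,
      fun ω => ?_⟩
    · have : k < K := hk.trans hi
      have hne : (⟨k, this⟩ : Fin K) ≠ ⟨i, hi⟩ := by simp; omega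
      simp only [B, t, this, dif_pos, Function.update_of_ne hne]
    · simp only [B, t, hi, dif_pos, Function.update_self]
      cases ω ⟨i, hi⟩ <;> simp
  set n : ℝ := (Fintype.card (Fin K → Bool) : ℝ) with hn
  have hnpos : 0 < n := by rw [hn]; exact_mod_cast Fintype.card_pos
  have hL : Real.log ε < 0 := Real.log_neg h0 h1
  -- The inequality for a fixed value `p` of the common randomness and of a reference message.
  have key : ∀ p : C.Q × Message,
      ∑ j ∈ Finset.range J, (c j : ℝ)⁻¹ * ∑ i ∈ Finset.Ico (m (j + 1)) (m j),
        (n * (Real.log 2 + Real.log (1 - ε)) + Real.log ε * ∑ ω,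
          C.condErrorProb (c j) N i (p.1, fun i => xor (t ω i) (p.2 i))) ≤
      N * (n * Real.log 2) := fun p =>
    sum_guess_le (B p.2) (fun ω => C.enc p.1 (B p.2 ω)) N K (fun y i => C.dec p.1 N y i)
      (hflip p.2) c c_anti c_pos m m_anti le_rfl h0 h1 J
  have hint : ∀ j i, ∀ ω : Fin K → Bool, Integrable (fun p : C.Q × Message =>
      C.condErrorProb (c j) N i (p.1, fun i => xor (t ω i) (p.2 i))) (C.law.prod messageLaw) :=
    fun j i ω => (C.measurePreserving_xor (t ω)).integrable_comp_of_integrable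
      (C.integrable_condErrorProb (c j) N i)
  have hint2 : ∀ j i, Integrable (fun p : C.Q × Message =>
      n * (Real.log 2 + Real.log (1 - ε)) + Real.log ε * ∑ ω,
      C.condErrorProb (c j) N i (p.1, fun i => xor (t ω i) (p.2 i))) (C.law.prod messageLaw) :=
    fun j i => (integrable_const _).add ((integrable_finsetSum _ fun ω _ => hint j i ω).const_mul _)
  have hval : ∀ j i, ∫ p : C.Q × Message, (n * (Real.log 2 + Real.log (1 - ε)) + Real.log ε * ∑ ω,
      C.condErrorProb (c j) N i (p.1, fun i => xor (t ω i) (p.2 i))) ∂C.law.prod messageLaw =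
      n * (Real.log 2 + Real.log (1 - ε) + Real.log ε * C.bitErrorProb (c j) N i) := by
    intro j i
    rw [integral_add (integrable_const _)
      ((integrable_finsetSum _ fun ω _ => hint j i ω).const_mul _),
      integral_const_mul (Real.log ε), integral_finsetSum _ fun ω _ => hint j i ω]
    have : ∀ ω : Fin K → Bool, ∫ p : C.Q × Message,
        C.condErrorProb (c j) N i (p.1, fun i => xor (t ω i) (p.2 i)) ∂C.law.prod messageLaw =
        C.bitErrorProb (c j) N i := by
      intro ω
      rw [bitErrorProb_eq_integral]
      have hmp := C.measurePreserving_xor (t ω)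
      conv_rhs => rw [← hmp.map_eq]
      rw [integral_map hmp.measurable.aemeasurable
        (C.measurable_condErrorProb _ _ _).aestronglyMeasurable]
    simp_rw [this]
    simp only [integral_const, probReal_univ, smul_eq_mul, one_mul, Finset.sum_const,
      Finset.card_univ, nsmul_eq_mul, ← hn]
    ring
  have hmain : ∑ j ∈ Finset.range J, (c j : ℝ)⁻¹ * ∑ i ∈ Finset.Ico (m (j + 1)) (m j),
      n * (Real.log 2 + Real.log (1 - ε) + Real.log ε * C.bitErrorProb (c j) N i) ≤
      N * (n * Real.log 2) := by
    have h := integral_mono (μ := C.law.prod messageLaw)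
      (integrable_finsetSum (Finset.range J) fun j _ => (integrable_finsetSum
        (Finset.Ico (m (j + 1)) (m j)) fun i _ => hint2 j i).const_mul (c j : ℝ)⁻¹)
      (integrable_const (N * (n * Real.log 2))) key
    rw [integral_finsetSum _ fun j _ => (integrable_finsetSum
        (Finset.Ico (m (j + 1)) (m j)) fun i _ => hint2 j i).const_mul (c j : ℝ)⁻¹] at h
    simp_rw [integral_const_mul] at h
    simp_rw [integral_finsetSum _ fun i _ => hint2 _ i, hval] at h
    simpa using h
  have hlow : (∑ j ∈ Finset.range J, (c j : ℝ)⁻¹ * ((m j : ℝ) - m (j + 1))) *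
      (Real.log 2 + Real.log (1 - ε) + ε * Real.log ε) * n ≤ N * Real.log 2 * n := by
    refine le_trans ?_ (hmain.trans_eq (by ring))
    rw [Finset.sum_mul, Finset.sum_mul]
    refine Finset.sum_le_sum fun j hj => ?_
    rw [mul_assoc, mul_assoc]
    refine mul_le_mul_of_nonneg_left ?_ (inv_nonneg.2 (c_pos j).le)
    have : ((m j : ℝ) - m (j + 1)) = ((Finset.Ico (m (j + 1)) (m j)).card : ℝ) := by
      rw [Nat.card_Ico, Nat.cast_sub (m_anti (Nat.le_succ j))]
    rw [this, ← nsmul_eq_mul]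
    refine Finset.card_nsmul_le_sum _ _ _ fun i hi => ?_
    rw [mul_comm]
    refine mul_le_mul_of_nonneg_left ?_ hnpos.le
    have := herr j (Finset.mem_range.1 hj) i (Finset.mem_Ico.1 hi).2
    nlinarith
  exact le_of_mul_le_mul_right hlow hnpos

end Code

end Converse

/-! ### From finitely many capacities to the Stieltjes integral -/

namespace RateCapacityFunction

variable (r : RateCapacityFunction)

open Filter in
/-- The converse for a finite decreasing sequence of capacities. -/
lemma Achievable.sum_le_one {r : RateCapacityFunction} (hr : Achievable.{u} r) (c : ℕ → I)
    (c_anti : Antitone c) (c_pos : ∀ j, 0 < (c j : ℝ)) (J : ℕ) :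
    ∑ j ∈ Finset.range J, (c j : ℝ)⁻¹ * ((r (c j) : ℝ) - r (c (j + 1))) ≤ 1 := by
  set a : ℝ → ℕ → ℝ := fun ε j => max ((r (c j) : ℝ) - ε) 0 with ha
  have key : ∀ ε : ℝ, 0 < ε → ε < 1 →
      (∑ j ∈ Finset.range J, (c j : ℝ)⁻¹ * (a ε j - a ε (j + 1))) *
        (Real.log 2 + Real.log (1 - ε) + ε * Real.log ε) ≤ Real.log 2 := by
    intro ε h0 h1
    obtain ⟨C, hC⟩ := hr ε h0
    choose N₀ hN₀ using fun j => hC (c j)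
    have hlim : ∀ j, Tendsto (fun N : ℕ => (⌊a ε j * (N : ℝ)⌋₊ : ℝ) / (N : ℝ)) atTop (𝓝 (a ε j)) :=
      fun j => (tendsto_nat_floor_mul_div_atTop (le_max_right _ _)).comp
        tendsto_natCast_atTop_atTop
    have hlim' : Tendsto (fun N : ℕ => (∑ j ∈ Finset.range J, (c j : ℝ)⁻¹ *
        ((⌊a ε j * (N : ℝ)⌋₊ : ℝ) / (N : ℝ) - (⌊a ε (j + 1) * (N : ℝ)⌋₊ : ℝ) / (N : ℝ))) *
        (Real.log 2 + Real.log (1 - ε) + ε * Real.log ε)) atTop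
        (𝓝 ((∑ j ∈ Finset.range J, (c j : ℝ)⁻¹ * (a ε j - a ε (j + 1))) *
        (Real.log 2 + Real.log (1 - ε) + ε * Real.log ε))) :=
      (tendsto_finsetSum _ fun j _ => ((hlim j).sub (hlim (j + 1))).const_mul _).mul_const _
    refine le_of_tendsto hlim' ?_
    filter_upwards [eventually_ge_atTop ((Finset.range J).sup N₀), eventually_gt_atTop 0]
      with N hN hN0
    have hNpos : (0 : ℝ) < N := by exact_mod_cast hN0
    have h := C.sum_le_of_bitErrorProb_le N c c_anti c_pos (fun j => ⌊a ε j * (N : ℝ)⌋₊) ?_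
      h0 h1 J ?_
    · rw [← div_le_iff₀' hNpos] at h
      refine le_trans (le_of_eq ?_) h
      rw [mul_div_right_comm, Finset.sum_div]
      congr 1
      refine Finset.sum_congr rfl fun j _ => ?_
      ring
    · intro i j hij
      refine Nat.floor_le_floor (mul_le_mul_of_nonneg_right (max_le_max_right _ ?_) hNpos.le)
      have : (r (c j) : ℝ) ≤ r (c i) := by exact_mod_cast r.monotone' (c_anti hij)
      linarith
    · intro j hj i hi
      have h3 : ((i + 1 : ℕ) : ℝ) ≤ a ε j * N :=
        (Nat.cast_le.2 hi).trans (Nat.floor_le (mul_nonneg (le_max_right _ _) hNpos.le))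
      have h4 : ((i + 1 : ℕ) : ℝ) ≤ N * ((r (c j) : ℝ) - ε) := by
        rcases max_cases ((r (c j) : ℝ) - ε) 0 with ⟨h, _⟩ | ⟨h, _⟩
        · simp only [ha, h] at h3; linarith
        · simp only [ha, h, zero_mul] at h3; push_cast at h3
          have : (0 : ℝ) ≤ i := Nat.cast_nonneg i
          linarith
      have := hN₀ j N ((Finset.le_sup (f := N₀) (Finset.mem_range.2 hj)).trans hN) (i + 1)
        (by omega) h4
      simpa using this
  have hcont : ContinuousAt (fun ε : ℝ => (∑ j ∈ Finset.range J, (c j : ℝ)⁻¹ *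
      (a ε j - a ε (j + 1))) * (Real.log 2 + Real.log (1 - ε) + ε * Real.log ε)) 0 := by
    refine ContinuousAt.mul ?_ ((ContinuousAt.add continuousAt_const ?_).add
      Real.continuous_mul_log.continuousAt)
    · simp only [ha]; fun_prop
    · exact (Real.continuousAt_log (by norm_num)).comp' (by fun_prop)
  have hle := le_of_tendsto (hcont.tendsto.mono_left (nhdsWithin_le_nhds (s := Ioi 0)))
    (b := Real.log 2) (by
      filter_upwards [self_mem_nhdsWithin, nhdsWithin_le_nhds (Iio_mem_nhds zero_lt_one)]
        with ε h0 h1 using key ε h0 h1)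
  have hL : 0 < Real.log 2 := Real.log_pos (by norm_num)
  simp only [ha, sub_zero, Real.log_one, add_zero, Real.log_zero, mul_zero,
    max_eq_left (NNReal.coe_nonneg _)] at hle
  exact (mul_le_iff_le_one_left hL).1 hle

lemma stieltjes_apply (c : I) : r.stieltjes c = r c := by
  change ((r (projIcc 0 1 zero_le_one (c : ℝ)) : ℝ≥0) : ℝ) = r c
  rw [projIcc_val]

lemma measure_Ioc_coe (a b : I) :
    r.stieltjes.measure (Ioc (a : ℝ) b) = ENNReal.ofReal ((r b : ℝ) - r a) := by
  rw [StieltjesFunction.measure_Ioc, stieltjes_apply, stieltjes_apply]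

lemma lintegral_Ioc_pow_succ (β : I) (J : ℕ) :
    ∫⁻ c in Ioc ((β ^ (J + 1) : I) : ℝ) 1, ENNReal.ofReal (1 / c) ∂r.stieltjes.measure =
      (∫⁻ c in Ioc ((β ^ J : I) : ℝ) 1, ENNReal.ofReal (1 / c) ∂r.stieltjes.measure) +
      ∫⁻ c in Ioc ((β ^ (J + 1) : I) : ℝ) (β ^ J : I), ENNReal.ofReal (1 / c)
        ∂r.stieltjes.measure := by
  have h1 : ((β ^ (J + 1) : I) : ℝ) ≤ (β ^ J : I) :=
    pow_le_pow_right_of_le_one' (a := β) β.2.2 (Nat.le_succ J)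
  rw [← Ioc_union_Ioc_eq_Ioc h1 (β ^ J : I).2.2,
    lintegral_union measurableSet_Ioc (Ioc_disjoint_Ioc_of_le le_rfl), add_comm]

/-- The upper Riemann–Stieltjes sum over a geometric partition. -/
lemma lintegral_Ioc_pow_le {β : I} (hβ : 0 < (β : ℝ)) (J : ℕ) :
    ∫⁻ c in Ioc ((β ^ J : I) : ℝ) 1, ENNReal.ofReal (1 / c) ∂r.stieltjes.measure ≤
      ENNReal.ofReal (∑ j ∈ Finset.range J, ((β ^ (j + 1) : I) : ℝ)⁻¹ *
        ((r (β ^ j) : ℝ) - r (β ^ (j + 1)))) := by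
  have hnn : ∀ j, (0 : ℝ) ≤ (r (β ^ j) : ℝ) - r (β ^ (j + 1)) := fun j => by
    rw [sub_nonneg]
    exact_mod_cast r.monotone' (pow_le_pow_right_of_le_one' β.2.2 (Nat.le_succ j))
  induction J with
  | zero => simp
  | succ J ih =>
    have hp : (0 : ℝ) < ((β ^ (J + 1) : I) : ℝ) := by rw [Set.Icc.coe_pow]; positivity
    rw [lintegral_Ioc_pow_succ, Finset.sum_range_succ, ENNReal.ofReal_add
      (Finset.sum_nonneg fun j _ => mul_nonneg (inv_nonneg.2 (β ^ (j + 1) : I).2.1) (hnn j))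
      (mul_nonneg (inv_nonneg.2 hp.le) (hnn J))]
    refine add_le_add ih ?_
    rw [ENNReal.ofReal_mul (inv_nonneg.2 hp.le), ← measure_Ioc_coe, ← setLIntegral_const]
    refine setLIntegral_mono measurable_const fun c hc => ENNReal.ofReal_le_ofReal ?_
    rw [one_div]
    exact inv_anti₀ hp hc.1.le

/-- The lower Riemann–Stieltjes sum over a geometric partition. -/
lemma le_lintegral_Ioc_pow {β : I} (hβ : 0 < (β : ℝ)) (J : ℕ) :
    ENNReal.ofReal (∑ j ∈ Finset.range J, ((β ^ j : I) : ℝ)⁻¹ *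
        ((r (β ^ j) : ℝ) - r (β ^ (j + 1)))) ≤
      ∫⁻ c in Ioc ((β ^ J : I) : ℝ) 1, ENNReal.ofReal (1 / c) ∂r.stieltjes.measure := by
  have hnn : ∀ j, (0 : ℝ) ≤ (r (β ^ j) : ℝ) - r (β ^ (j + 1)) := fun j => by
    rw [sub_nonneg]
    exact_mod_cast r.monotone' (pow_le_pow_right_of_le_one' β.2.2 (Nat.le_succ j))
  induction J with
  | zero => simp
  | succ J ih =>
    have hp : (0 : ℝ) < ((β ^ (J + 1) : I) : ℝ) := by rw [Set.Icc.coe_pow]; positivity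
    rw [lintegral_Ioc_pow_succ, Finset.sum_range_succ, ENNReal.ofReal_add
      (Finset.sum_nonneg fun j _ => mul_nonneg (inv_nonneg.2 (β ^ j : I).2.1) (hnn j))
      (mul_nonneg (inv_nonneg.2 (β ^ J : I).2.1) (hnn J))]
    refine add_le_add ih ?_
    rw [ENNReal.ofReal_mul (inv_nonneg.2 (β ^ J : I).2.1), ← measure_Ioc_coe, ← setLIntegral_const]
    refine setLIntegral_mono_ae (by fun_prop) (ae_of_all _ fun c hc => ENNReal.ofReal_le_ofReal ?_)
    rw [one_div]
    exact inv_anti₀ (hp.trans hc.1) hc.2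

/-- As `r` vanishes near `0`, it vanishes at a power of any `β < 1`. -/
lemma exists_pow_eq_zero {β : I} (hβ1 : (β : ℝ) < 1) : ∃ J : ℕ, r (β ^ J) = 0 := by
  obtain ⟨η, hη, h⟩ := r.zero_near_zero'
  obtain ⟨J, hJ⟩ := exists_pow_lt_of_lt_one hη hβ1
  exact ⟨J, h _ (by rw [Set.Icc.coe_pow]; exact hJ.le)⟩

lemma inverseCapacityIntegral_eq {β : I} {J : ℕ} (hJ : r (β ^ J) = 0) :
    r.inverseCapacityIntegral =
      ∫⁻ c in Ioc ((β ^ J : I) : ℝ) 1, ENNReal.ofReal (1 / c) ∂r.stieltjes.measure := by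
  unfold inverseCapacityIntegral
  have h0 : r.stieltjes.measure (Ioc 0 ((β ^ J : I) : ℝ)) = 0 := by
    have := r.measure_Ioc_coe 0 (β ^ J)
    rw [hJ, Icc.coe_zero] at this
    rw [this]
    simp
  rw [← Ioc_union_Ioc_eq_Ioc (β ^ J : I).2.1 (β ^ J : I).2.2,
    lintegral_union measurableSet_Ioc (Ioc_disjoint_Ioc_of_le le_rfl),
    setLIntegral_measure_zero _ _ h0, zero_add]

theorem Achievable.inverseCapacityIntegral_le_one {r : RateCapacityFunction}
    (hr : Achievable.{u} r) : r.inverseCapacityIntegral ≤ 1 := by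
  have key : ∀ β : ℝ, 0 < β → β < 1 → r.inverseCapacityIntegral ≤ ENNReal.ofReal β⁻¹ := by
    intro b h0 h1
    set β : I := ⟨b, h0.le, h1.le⟩ with hβ
    obtain ⟨J, hJ⟩ := r.exists_pow_eq_zero (β := β) h1
    rw [r.inverseCapacityIntegral_eq hJ]
    refine (r.lintegral_Ioc_pow_le (β := β) h0 J).trans (ENNReal.ofReal_le_ofReal ?_)
    have h := hr.sum_le_one (fun j => β ^ j) (fun i j hij => pow_le_pow_right_of_le_one' β.2.2 hij)
      (fun j => by rw [Set.Icc.coe_pow]; exact pow_pos h0 j) J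
    calc ∑ j ∈ Finset.range J, ((β ^ (j + 1) : I) : ℝ)⁻¹ * ((r (β ^ j) : ℝ) - r (β ^ (j + 1)))
        = b⁻¹ * ∑ j ∈ Finset.range J, ((β ^ j : I) : ℝ)⁻¹ *
            ((r (β ^ j) : ℝ) - r (β ^ (j + 1))) := by
          rw [Finset.mul_sum]
          refine Finset.sum_congr rfl fun j _ => ?_
          rw [pow_succ, Set.Icc.coe_mul, mul_inv]
          ring
      _ ≤ b⁻¹ * 1 := mul_le_mul_of_nonneg_left h (inv_nonneg.2 h0.le)
      _ = b⁻¹ := mul_one _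
  have hlim : Filter.Tendsto (fun b : ℝ => ENNReal.ofReal b⁻¹) (𝓝[<] 1) (𝓝 1) := by
    have : ContinuousAt (fun b : ℝ => ENNReal.ofReal b⁻¹) 1 :=
      ENNReal.continuous_ofReal.continuousAt.comp (continuousAt_inv₀ one_ne_zero)
    simpa using this.tendsto.mono_left nhdsWithin_le_nhds
  refine ge_of_tendsto hlim ?_
  filter_upwards [self_mem_nhdsWithin, nhdsWithin_le_nhds (Ioi_mem_nhds zero_lt_one)]
    with b h1 h0 using key b h0 h1

end RateCapacityFunction

/-! ### Random codes in layers and the union bound -/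

section LayeredCode

/-- The law of a layer index: layer `l < J` has probability `p l`. -/
noncomputable def layerLaw (p : ℕ → ℝ≥0) (J : ℕ) : Measure ℕ :=
  ∑ l ∈ Finset.range J, (p l : ℝ≥0∞) • Measure.dirac l

/-- The law of a uniformly random function from bit strings to bits. -/
noncomputable def randomFunctionLaw : Measure (List Bool → Bool) :=
  Measure.infinitePi fun _ => bernoulliMeasure true false ⟨1 / 2, by norm_num, by norm_num⟩

instance : IsProbabilityMeasure randomFunctionLaw := by unfold randomFunctionLaw; infer_instance

lemma isProbabilityMeasure_layerLaw {p : ℕ → ℝ≥0} {J : ℕ} (hp : ∑ l ∈ Finset.range J, p l = 1) :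
    IsProbabilityMeasure (layerLaw p J) := by
  constructor
  simp only [layerLaw, Measure.finsetSum_apply, Measure.smul_apply, measure_univ, smul_eq_mul,
    mul_one]
  exact_mod_cast hp

lemma lintegral_layerLaw (p : ℕ → ℝ≥0) (J : ℕ) (f : ℕ → ℝ≥0∞) :
    ∫⁻ l, f l ∂layerLaw p J = ∑ l ∈ Finset.range J, p l * f l := by
  simp only [layerLaw, lintegral_finsetSum_measure, lintegral_smul_measure, lintegral_dirac]
  rfl

/-- The first `L` bits of a message. -/
def messagePrefix (M : Message) (L : ℕ) : List Bool := (List.range L).map M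

lemma messagePrefix_eq_iff {M M' : Message} {L : ℕ} :
    messagePrefix M L = messagePrefix M' L ↔ ∀ k < L, M k = M' k := by
  simp [messagePrefix, List.map_inj_left]

lemma measurable_messagePrefix (L : ℕ) : @Measurable Message (List Bool) _ ⊤
    (fun M => messagePrefix M L) := by
  let _ : MeasurableSpace (List Bool) := ⊤
  exact measurable_of_dependsOn_lt L fun M M' h => messagePrefix_eq_iff.2 h

/-- The number of message bits that determine symbol `j` if the layer of that symbol is `l`. -/
noncomputable def prefixLength (s : ℕ → ℝ≥0) (l j : ℕ) : ℕ := ⌊(j : ℝ) * s l⌋₊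

/-- Symbol `j` of the layered code: the random function `q.2 j`, evaluated at the prefix of the
message whose length is prescribed by the random layer `q.1 j`. -/
noncomputable def layeredEnc (s : ℕ → ℝ≥0) (q : (ℕ → ℕ) × (ℕ → List Bool → Bool)) (M : Message)
    (j : ℕ) : Bool :=
  q.2 j (messagePrefix M (prefixLength s (q.1 j) j))

lemma layeredEnc_congr (s : ℕ → ℝ≥0) (q : (ℕ → ℕ) × (ℕ → List Bool → Bool)) {M M' : Message}
    {j : ℕ} (h : ∀ k < prefixLength s (q.1 j) j, M k = M' k) :
    layeredEnc s q M j = layeredEnc s q M' j := by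
  unfold layeredEnc
  rw [messagePrefix_eq_iff.2 h]

lemma measurable_layeredEnc (s : ℕ → ℝ≥0) (j : ℕ) :
    Measurable fun x : ((ℕ → ℕ) × (ℕ → List Bool → Bool)) × Message => layeredEnc s x.1 x.2 j := by
  let _ : MeasurableSpace (List Bool) := ⊤
  have h1 : Measurable fun x : (List Bool → Bool) × List Bool => x.1 x.2 :=
    measurable_from_prod_countable_left fun u => measurable_pi_apply u
  have h2 : Measurable fun x : ℕ × Message => messagePrefix x.2 (prefixLength s x.1 j) :=
    measurable_from_prod_countable_right fun l =>
      measurable_messagePrefix (prefixLength s l j)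
  have h3 : Measurable fun x : ((ℕ → ℕ) × (ℕ → List Bool → Bool)) × Message =>
      messagePrefix x.2 (prefixLength s (x.1.1 j) j) :=
    h2.comp (f := fun x : ((ℕ → ℕ) × (ℕ → List Bool → Bool)) × Message => (x.1.1 j, x.2))
      (by fun_prop)
  exact h1.comp (f := fun x : ((ℕ → ℕ) × (ℕ → List Bool → Bool)) × Message =>
    (x.1.2 j, messagePrefix x.2 (prefixLength s (x.1.1 j) j))) (Measurable.prodMk (by fun_prop) h3)

open scoped Classical in
/-- The decoder looks for messages with finitely many ones that are consistent with the received
symbols, and declares bit `i` to be one if it is one in some such message. -/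
noncomputable def layeredDec (s : ℕ → ℝ≥0) (q : (ℕ → ℕ) × (ℕ → List Bool → Bool)) (n : ℕ)
    (y : Fin n → RecSymbol) (i : ℕ) : Bool :=
  decide (∃ F : Finset ℕ, (∀ j : Fin n, ∀ b, y j = some b →
    layeredEnc s q (fun k => decide (k ∈ F)) j = b) ∧ i ∈ F)

lemma measurable_layeredDec (s : ℕ → ℝ≥0) (n : ℕ) (y : Fin n → RecSymbol) (i : ℕ) :
    Measurable fun q => layeredDec s q n y i := by
  refine measurable_to_bool ?_
  have : (fun q => layeredDec s q n y i) ⁻¹' {true} = {q | ∃ F : Finset ℕ, (∀ j : Fin n, ∀ b,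
      y j = some b → layeredEnc s q (fun k => decide (k ∈ F)) j = b) ∧ i ∈ F} := by
    ext q; simp [layeredDec]
  rw [this]
  refine measurableSet_setOfPred.2 (Measurable.exists fun F =>
    Measurable.and (Measurable.forall fun j =>
    Measurable.forall fun b => Measurable.imp measurable_const (measurableSet_setOfPred.1 ?_))
    measurable_const)
  exact measurableSet_eq_fun ((measurable_layeredEnc s j).comp
    (measurable_id.prodMk measurable_const)) measurable_const

/-- A wrong decision about bit `i` exhibits a message consistent with the received symbols that
differs from the transmitted one in bit `i`. -/
lemma exists_of_layeredDec_ne (s : ℕ → ℝ≥0) (q : (ℕ → ℕ) × (ℕ → List Bool → Bool)) (N i : ℕ)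
    (M : Message) (E : ℕ → Bool)
    (h : M i ≠ layeredDec s q N (fun j => channelOutput (layeredEnc s q M) E j) i) :
    ∃ M' : Message, M' i ≠ M i ∧
      ∀ j < N, E j = false → layeredEnc s q M' j = layeredEnc s q M j := by
  have hcons : ∀ M' : Message, (∀ j : Fin N, ∀ b, channelOutput (layeredEnc s q M) E j = some b →
      layeredEnc s q M' j = b) ↔
      ∀ j < N, E j = false → layeredEnc s q M' j = layeredEnc s q M j := by
    intro M'
    refine ⟨fun h j hj hE => h ⟨j, hj⟩ _ (by simp [channelOutput, hE]), fun h j b hb => ?_⟩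
    by_cases hE : E j = true
    · simp [channelOutput, hE] at hb
    · simp only [channelOutput, hE] at hb
      rw [h j j.2 (by simpa using hE)]
      simpa using hb
  have hdec : layeredDec s q N (fun j => channelOutput (layeredEnc s q M) E j) i = true ↔
      ∃ F : Finset ℕ, (∀ j < N, E j = false → layeredEnc s q (fun k => decide (k ∈ F)) j =
        layeredEnc s q M j) ∧ i ∈ F := by
    classical
    unfold layeredDec
    exact decide_eq_true_iff.trans <| exists_congr fun F => and_congr_left' (hcons _)
  cases hM : M i
  · rw [hM] at h
    obtain ⟨F, hF, hi⟩ := hdec.1 (Bool.eq_true_of_not_eq_false (Ne.symm h))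
    exact ⟨_, by simp [hi], hF⟩
  · rw [hM] at h
    refine absurd (hdec.2 ?_).symm h
    set L := (Finset.range N).sup (fun j => prefixLength s (q.1 j) j) + (i + 1) with hL
    refine ⟨(Finset.range L).filter fun k => M k = true, fun j hj _ => ?_, by
      simp only [Finset.mem_filter, Finset.mem_range]; exact ⟨by omega, hM⟩⟩
    refine layeredEnc_congr s q fun k hk => ?_
    have : prefixLength s (q.1 j) j ≤ _ :=
      Finset.le_sup (f := fun j => prefixLength s (q.1 j) j) (Finset.mem_range.2 hj)
    have hkL : k < L := by omega
    simp [hkL]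

lemma randomFunctionLaw_eq {u v : List Bool} (h : u ≠ v) :
    randomFunctionLaw {a | a u = a v} = 2⁻¹ := by
  classical
  have hset : {a : List Bool → Bool | a u = a v} =
      (Set.pi (({u, v} : Finset (List Bool)) : Set (List Bool)) fun _ => {true}) ∪
      (Set.pi (({u, v} : Finset (List Bool)) : Set (List Bool)) fun _ => {false}) := by
    ext a
    simp only [mem_ofPred_eq, mem_union, Set.mem_pi, Finset.coe_insert, Finset.coe_singleton,
      mem_insert_iff, mem_singleton_iff, forall_eq_or_imp, forall_eq]
    cases a u <;> cases a v <;> simp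
  have hdisj : Disjoint
      (Set.pi (({u, v} : Finset (List Bool)) : Set (List Bool)) fun _ => ({true} : Set Bool))
      (Set.pi (({u, v} : Finset (List Bool)) : Set (List Bool)) fun _ => ({false} : Set Bool)) := by
    rw [Set.disjoint_left]
    intro a h1 h2
    have h1 := h1 u (by simp)
    have h2 := h2 u (by simp)
    simp_all
  have hm : ∀ b : Bool, MeasurableSet
      (Set.pi (({u, v} : Finset (List Bool)) : Set (List Bool)) fun _ => ({b} : Set Bool)) :=
    fun b => MeasurableSet.pi (Finset.countable_toSet _) fun _ _ => measurableSet_singleton b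
  rw [hset, measure_union hdisj (hm _)]
  unfold randomFunctionLaw
  rw [Measure.infinitePi_pi _ fun _ _ => measurableSet_singleton _,
    Measure.infinitePi_pi _ fun _ _ => measurableSet_singleton _, Finset.prod_pair h,
    Finset.prod_pair h]
  have e : ∀ b : Bool, bernoulliMeasure true false (⟨1 / 2, by norm_num, by norm_num⟩ : I) {b} =
      2⁻¹ := by
    have e' : ∀ (p : I) (b : Bool), σ p = p →
        bernoulliMeasure true false p {b} = (unitInterval.toNNReal p : ℝ≥0∞) := by
      intro p b hp
      rw [bernoulliMeasure_def, hp]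
      cases b <;> simp
    intro b
    rw [e' _ _ (Subtype.ext (by norm_num [unitInterval.symm])),
      show unitInterval.toNNReal ⟨1 / 2, by norm_num, by norm_num⟩ = (2⁻¹ : ℝ≥0) from
        NNReal.coe_injective (by change (1 / 2 : ℝ) = ((2⁻¹ : ℝ≥0) : ℝ); norm_num)]
    simp
  rw [e, e, ← mul_add, ENNReal.inv_two_add_inv_two, mul_one]

/-- Random functions agree on two distinct strings with probability one half, independently. -/
lemma infinitePi_randomFunctionLaw_agree (T : Finset ℕ) (u v : ℕ → List Bool)
    (h : ∀ j ∈ T, u j ≠ v j) :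
    (Measure.infinitePi fun _ : ℕ => randomFunctionLaw) {A | ∀ j ∈ T, A j (u j) = A j (v j)} =
      2⁻¹ ^ T.card := by
  have : {A : ℕ → List Bool → Bool | ∀ j ∈ T, A j (u j) = A j (v j)} =
      Set.pi (T : Set ℕ) fun j => {a | a (u j) = a (v j)} := by
    ext A; simp [Set.mem_pi]
  have hm : ∀ j ∈ T, MeasurableSet {a : List Bool → Bool | a (u j) = a (v j)} := fun j _ =>
    measurableSet_eq_fun (measurable_pi_apply _) (measurable_pi_apply _)
  rw [this, Measure.infinitePi_pi _ hm, ← Finset.prod_const]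
  exact Finset.prod_congr rfl fun j hj => randomFunctionLaw_eq (h j hj)

/-- The symbols among the first `N` that are received and depend on bit `b` and on the first `n`
bits only. -/
noncomputable def usefulTimes (s : ℕ → ℝ≥0) (lev : ℕ → ℕ) (E : ℕ → Bool) (N n b : ℕ) : Finset ℕ :=
  (Finset.range N).filter fun j =>
    E j = false ∧ b < prefixLength s (lev j) j ∧ prefixLength s (lev j) j ≤ n

/-- The union bound over the wrong messages, sorted by the first index `b` in which they differ from
the transmitted message; only the symbols determined by the first `n` bits are used. -/
lemma measure_exists_consistent_le (s : ℕ → ℝ≥0) (lev : ℕ → ℕ) (M : Message) (E : ℕ → Bool)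
    {N n m i : ℕ} (him : i < m) :
    (Measure.infinitePi fun _ : ℕ => randomFunctionLaw) {A | ∃ M' : Message, M' i ≠ M i ∧
      ∀ j < N, E j = false → layeredEnc s (lev, A) M' j = layeredEnc s (lev, A) M j} ≤
    ∑ b ∈ Finset.range m, min 1 (2 ^ (n - b) * 2⁻¹ ^ (usefulTimes s lev E N n b).card) := by
  classical
  let w : (b : ℕ) → (Fin (n - b) → Bool) → Message := fun b t k =>
    if k < b then M k else if k = b then !M b else if h : k - b < n - b then t ⟨k - b, h⟩ else M k
  let S : ℕ → Set (ℕ → List Bool → Bool) := fun b => ⋃ t : Fin (n - b) → Bool,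
    {A | ∀ j ∈ usefulTimes s lev E N n b, A j (messagePrefix (w b t) (prefixLength s (lev j) j)) =
      A j (messagePrefix M (prefixLength s (lev j) j))}
  have hsub : {A | ∃ M' : Message, M' i ≠ M i ∧
      ∀ j < N, E j = false → layeredEnc s (lev, A) M' j = layeredEnc s (lev, A) M j} ⊆
      ⋃ b ∈ Finset.range m, S b := by
    rintro A ⟨M', hne, hM'⟩
    obtain ⟨b, hb1, hb2, hbi⟩ : ∃ b, M' b ≠ M b ∧ (∀ k < b, M' k = M k) ∧ b ≤ i := by
      have hex : ∃ b, M' b ≠ M b := ⟨i, hne⟩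
      exact ⟨Nat.find hex, Nat.find_spec hex, fun k hk => not_not.1 (Nat.find_min hex hk),
        Nat.find_le hne⟩
    simp only [S, mem_iUnion, Finset.mem_range]
    refine ⟨b, by omega, fun k => M' (b + k), fun j hj => ?_⟩
    simp only [usefulTimes, Finset.mem_filter, Finset.mem_range] at hj
    rw [← show layeredEnc s (lev, A) M j = A j (messagePrefix M (prefixLength s (lev j) j)) from rfl,
      ← hM' j hj.1 hj.2.1]
    unfold layeredEnc
    simp only
    congr 1
    refine messagePrefix_eq_iff.2 fun k hk => ?_
    simp only [w]
    split_ifs with h1 h2 h3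
    · exact (hb2 k h1).symm
    · rw [h2]
      revert hb1
      cases M' b <;> cases M b <;> simp
    · congr 1; omega
    · omega
  refine (measure_mono hsub).trans ((measure_biUnion_finset_le _ _).trans
    (Finset.sum_le_sum fun b _ => le_min prob_le_one ?_))
  refine (measure_iUnion_fintype_le _ _).trans ?_
  refine (Finset.sum_le_card_nsmul _ _ (2⁻¹ ^ (usefulTimes s lev E N n b).card) ?_).trans_eq ?_
  · intro t _
    rw [infinitePi_randomFunctionLaw_agree]
    intro j hj h
    simp only [usefulTimes, Finset.mem_filter, Finset.mem_range] at hj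
    have := messagePrefix_eq_iff.1 h b hj.2.2.1
    simp [w] at this
  · simp

/-- For `1/2 ≤ x ≤ 1` the truncated union bound is at most a product of independent factors. -/
lemma min_one_le_mul_pow {x : ℝ} (hx : 1 / 2 ≤ x) (hx1 : x ≤ 1) (k t : ℕ) :
    min 1 ((2 : ℝ≥0∞) ^ k * 2⁻¹ ^ t) ≤ ENNReal.ofReal (x⁻¹ ^ k) * ENNReal.ofReal x ^ t := by
  have hx0 : 0 < x := by linarith
  have e1 : min 1 ((2 : ℝ≥0∞) ^ k * 2⁻¹ ^ t) = ENNReal.ofReal (min 1 (2 ^ k * 2⁻¹ ^ t)) := by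
    rw [ENNReal.ofReal_min, ENNReal.ofReal_one, ENNReal.ofReal_mul (by positivity),
      ENNReal.ofReal_pow (by norm_num), ENNReal.ofReal_pow (by norm_num),
      ENNReal.ofReal_inv_of_pos (by norm_num)]
    simp
  rw [e1, ← ENNReal.ofReal_pow hx0.le, ← ENNReal.ofReal_mul (by positivity)]
  refine ENNReal.ofReal_le_ofReal ?_
  rw [inv_pow x, inv_mul_eq_div, le_div_iff₀ (by positivity)]
  rcases le_total t k with h | h
  · calc min 1 (2 ^ k * 2⁻¹ ^ t) * x ^ k ≤ 1 * x ^ k :=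
        mul_le_mul_of_nonneg_right (min_le_left _ _) (by positivity)
      _ ≤ x ^ t := by rw [one_mul]; exact pow_le_pow_of_le_one hx0.le hx1 h
  · obtain ⟨d, rfl⟩ := Nat.exists_eq_add_of_le h
    calc min 1 (2 ^ k * 2⁻¹ ^ (k + d)) * x ^ k ≤ (2 ^ k * 2⁻¹ ^ (k + d)) * x ^ k :=
        mul_le_mul_of_nonneg_right (min_le_right _ _) (by positivity)
      _ = (1 / 2) ^ d * x ^ k := by
        rw [pow_add, ← mul_assoc, ← mul_pow]; norm_num
      _ ≤ x ^ d * x ^ k := mul_le_mul_of_nonneg_right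
          (pow_le_pow_left₀ (by norm_num) hx d) (by positivity)
      _ = x ^ (k + d) := by rw [pow_add, mul_comm]

end LayeredCode

/-! ### Error exponents of layered codes -/

section LayeredCode

/-- The layered code with layer probabilities `p` and layer rates `s`.  The common randomness
consists of independent layer indices and of independent random functions. -/
noncomputable def layeredCode (p s : ℕ → ℝ≥0) (J : ℕ) (hp : ∑ l ∈ Finset.range J, p l = 1) :
    Code.{u} where
  Q := ULift.{u} ((ℕ → ℕ) × (ℕ → List Bool → Bool))
  law :=
    have := isProbabilityMeasure_layerLaw hp
    ((Measure.infinitePi fun _ : ℕ => layerLaw p J).prod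
      (Measure.infinitePi fun _ : ℕ => randomFunctionLaw)).map ULift.up
  isProbabilityMeasure_law :=
    have := isProbabilityMeasure_layerLaw hp
    Measure.isProbabilityMeasure_map MeasurableEquiv.ulift.symm.measurable.aemeasurable
  enc q M j := layeredEnc s q.down M j
  dec q n y i := layeredDec s q.down n y i
  measurable_enc j := (measurable_layeredEnc s j).comp
    ((MeasurableEquiv.ulift.measurable.comp measurable_fst).prodMk measurable_snd)
  measurable_dec n y i := (measurable_layeredDec s n y i).comp MeasurableEquiv.ulift.measurable

/-- The expected value of a product of functions of independent coordinates. -/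
lemma lintegral_infinitePi_prod {α : Type*} [MeasurableSpace α] (μ : Measure α)
    [IsProbabilityMeasure μ] (g : ℕ → α → ℝ≥0∞) (hg : ∀ j, Measurable (g j)) (T : Finset ℕ) :
    ∫⁻ ω, ∏ j ∈ T, g j (ω j) ∂(Measure.infinitePi fun _ : ℕ => μ) = ∏ j ∈ T, ∫⁻ a, g j a ∂μ := by
  rw [lintegral_prod_eq_prod_lintegral_of_indepFun T (fun j (ω : ℕ → α) => g j (ω j))
    (iIndepFun_infinitePi hg) (fun j => (hg j).comp (measurable_pi_apply j))]
  refine Finset.prod_congr rfl fun j _ => ?_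
  exact (measurePreserving_eval_infinitePi (fun _ : ℕ => μ) j).lintegral_comp (hg j)

lemma lintegral_bernoulliMeasure (c : I) (f : Bool → ℝ≥0∞) :
    ∫⁻ e, f e ∂bernoulliMeasure false true c =
      ENNReal.ofReal c * f false + ENNReal.ofReal (1 - c) * f true := by
  have e1 : ENNReal.ofReal (c : ℝ) = (unitInterval.toNNReal c : ℝ≥0∞) := by
    rw [ENNReal.ofReal, ENNReal.coe_inj, ← NNReal.coe_inj, Real.coe_toNNReal _ c.2.1]; rfl
  have e2 : ENNReal.ofReal (1 - (c : ℝ)) = (unitInterval.toNNReal (σ c) : ℝ≥0∞) := by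
    rw [ENNReal.ofReal, ENNReal.coe_inj, ← NNReal.coe_inj,
      Real.coe_toNNReal _ (sub_nonneg.2 c.2.2)]; rfl
  rw [bernoulliMeasure_def, lintegral_add_measure, lintegral_smul_measure, lintegral_smul_measure,
    lintegral_dirac, lintegral_dirac, e1, e2]
  rfl

/-- To bound the error probability of the layered code it suffices to bound, for fixed layers,
message and erasures, the probability over the random functions that a wrong message is
consistent with the received symbols. -/
lemma jointLaw_layeredCode_le (p s : ℕ → ℝ≥0) (J : ℕ) [IsProbabilityMeasure (layerLaw p J)]
    (hp : ∑ l ∈ Finset.range J, p l = 1) (c : I)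
    (N i : ℕ) (F : (ℕ → ℕ) → (ℕ → Bool) → ℝ≥0∞) (hF : ∀ lev M E,
      (Measure.infinitePi fun _ : ℕ => randomFunctionLaw) {A | ∃ M' : Message, M' i ≠ M i ∧
        ∀ j < N, E j = false → layeredEnc s (lev, A) M' j = layeredEnc s (lev, A) M j} ≤ F lev E)
    (hFm : Measurable fun E => ∫⁻ lev, F lev E ∂(Measure.infinitePi fun _ : ℕ => layerLaw p J)) :
    (layeredCode.{u} p s J hp).jointLaw c
      {ω | ω.2.1 i ≠ (layeredCode.{u} p s J hp).estimate N i ω} ≤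
      ∫⁻ E, ∫⁻ lev, F lev E ∂(Measure.infinitePi fun _ : ℕ => layerLaw p J) ∂erasureLaw c := by
  have hS := (layeredCode.{u} p s J hp).measurableSet_error N i
  set S := {ω : (layeredCode.{u} p s J hp).Q × Message × (ℕ → Bool) |
    ω.2.1 i ≠ (layeredCode.{u} p s J hp).estimate N i ω} with hSdef
  unfold Code.jointLaw
  rw [Measure.prod_apply_symm hS]
  have hsnd : ∫⁻ E, ∫⁻ lev, F lev E ∂(Measure.infinitePi fun _ : ℕ => layerLaw p J) ∂erasureLaw c =
      ∫⁻ z, ∫⁻ lev, F lev z.2 ∂(Measure.infinitePi fun _ : ℕ => layerLaw p J)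
        ∂messageLaw.prod (erasureLaw c) := by
    have h := (measurePreserving_snd (μ := messageLaw) (ν := erasureLaw c)).lintegral_comp hFm
    exact h.symm
  rw [hsnd]
  refine lintegral_mono fun z => ?_
  have hup : Measurable (ULift.up : (ℕ → ℕ) × (ℕ → List Bool → Bool) → ULift.{u} _) :=
    MeasurableEquiv.ulift.symm.measurable
  have hslice : MeasurableSet ((fun x => (x, z)) ⁻¹' S) :=
    (measurable_id.prodMk measurable_const) hS
  refine (le_of_eq (Measure.map_apply hup hslice)).trans ?_
  refine (le_of_eq (Measure.prod_apply (hup hslice))).trans ?_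
  refine lintegral_mono fun lev => (measure_mono ?_).trans (hF lev z.1 z.2)
  intro A hA
  exact exists_of_layeredDec_ne s (lev, A) N i z.1 z.2 hA

/-- In the layers of rate at least `ρ`, the symbols that depend on bit `b` and on the first `n` bits
only have the frequency prescribed by the rate. -/
lemma le_card_prefixLength {s : ℕ → ℝ≥0} {l N n b : ℕ} {ρ : ℝ} (hρ : 0 < ρ) (hs : ρ ≤ s l)
    (hn : (n : ℝ) ≤ ρ * N) :
    ((n : ℝ) - b - 1) / s l - 1 ≤ ((Finset.range N).filter fun j =>
      b < prefixLength s l j ∧ prefixLength s l j ≤ n).card := by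
  have hspos : (0 : ℝ) < s l := hρ.trans_le hs
  have hsub : Finset.Ico ⌈((b : ℝ) + 1) / s l⌉₊ ⌈(n : ℝ) / s l⌉₊ ⊆ (Finset.range N).filter fun j =>
      b < prefixLength s l j ∧ prefixLength s l j ≤ n := by
    intro j hj
    rw [Finset.mem_Ico, Nat.ceil_le, Nat.lt_ceil, div_le_iff₀ hspos, lt_div_iff₀ hspos] at hj
    refine Finset.mem_filter.2 ⟨Finset.mem_range.2 ?_,
      Nat.le_floor (by push_cast; exact hj.1), ?_⟩
    · have : (j : ℝ) * s l < N * s l := by nlinarith [Nat.cast_nonneg (α := ℝ) N]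
      exact_mod_cast lt_of_mul_lt_mul_right this hspos.le
    · exact Nat.floor_le_of_le hj.2.le
  have hcard := Finset.card_le_card hsub
  rw [Nat.card_Ico] at hcard
  have h1 : (n : ℝ) / s l ≤ ⌈(n : ℝ) / s l⌉₊ := Nat.le_ceil _
  have h2 : (⌈((b : ℝ) + 1) / s l⌉₊ : ℝ) < ((b : ℝ) + 1) / s l + 1 :=
    Nat.ceil_lt_add_one (by positivity)
  have h3 : (⌈(n : ℝ) / s l⌉₊ : ℝ) ≤ ((Finset.range N).filter fun j =>
      b < prefixLength s l j ∧ prefixLength s l j ≤ n).card + ⌈((b : ℝ) + 1) / s l⌉₊ := by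
    exact_mod_cast Nat.sub_le_iff_le_add.1 hcard
  have h4 : ((n : ℝ) - b - 1) / s l = (n : ℝ) / s l - ((b : ℝ) + 1) / s l := by ring
  rw [h4]
  linarith

/-- The exponential moment of the number of useful received symbols. -/
lemma lintegral_pow_card_usefulTimes_le (p s : ℕ → ℝ≥0) (J : ℕ)
    [IsProbabilityMeasure (layerLaw p J)] (hp : ∑ l ∈ Finset.range J, p l = 1) (c : I)
    {ρ : ℝ≥0} (hρ : 0 < ρ) {x : ℝ} (hx0 : 0 ≤ x)
    (hx1 : x ≤ 1) {N n b : ℕ} (hn : (n : ℝ) ≤ ρ * N) :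
    ∫⁻ E, ∫⁻ lev, ENNReal.ofReal x ^ (usefulTimes s lev E N n b).card
      ∂(Measure.infinitePi fun _ : ℕ => layerLaw p J) ∂erasureLaw c ≤
    ENNReal.ofReal (Real.exp (-(1 - x) * ((c * ∑ l ∈ (Finset.range J).filter fun l => ρ ≤ s l,
      (p l : ℝ) / s l) * ((n : ℝ) - b - 1) - 1))) := by
  classical
  let U : ℕ → ℕ → Prop := fun l j => b < prefixLength s l j ∧ prefixLength s l j ≤ n
  let g : ℕ → ℕ → Bool → ℝ≥0∞ := fun j l e => if e = false ∧ U l j then ENNReal.ofReal x else 1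
  have h1 : ∀ lev E, ENNReal.ofReal x ^ (usefulTimes s lev E N n b).card =
      ∏ j ∈ Finset.range N, g j (lev j) (E j) := by
    intro lev E
    rw [← Finset.prod_const, usefulTimes, Finset.prod_filter]
  simp_rw [h1]
  have h2 : ∀ E : ℕ → Bool, ∫⁻ lev, ∏ j ∈ Finset.range N, g j (lev j) (E j)
      ∂(Measure.infinitePi fun _ : ℕ => layerLaw p J) =
      ∏ j ∈ Finset.range N, ∑ l ∈ Finset.range J, p l * g j l (E j) := by
    intro E
    rw [lintegral_infinitePi_prod (layerLaw p J) (fun j l => g j l (E j))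
      (fun j => measurable_of_countable _)]
    simp_rw [lintegral_layerLaw]
  simp_rw [h2]
  unfold erasureLaw
  rw [lintegral_infinitePi_prod (bernoulliMeasure false true c)
    (fun j e => ∑ l ∈ Finset.range J, p l * g j l e) (fun j => measurable_of_finite _)]
  let freq : ℕ → ℝ := fun j => ∑ l ∈ Finset.range J, if U l j then (p l : ℝ) else 0
  have hpR : ∑ l ∈ Finset.range J, (p l : ℝ) = 1 := by exact_mod_cast hp
  have h3 : ∀ j, ∫⁻ e, ∑ l ∈ Finset.range J, p l * g j l e ∂bernoulliMeasure false true c ≤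
      ENNReal.ofReal (Real.exp (-(1 - x) * (c * freq j))) := by
    intro j
    have hval : ∀ e, ∑ l ∈ Finset.range J, p l * g j l e =
        ENNReal.ofReal (∑ l ∈ Finset.range J, p l * if e = false ∧ U l j then x else 1) := by
      intro e
      rw [ENNReal.ofReal_sum_of_nonneg fun l _ => by positivity]
      refine Finset.sum_congr rfl fun l _ => ?_
      rw [ENNReal.ofReal_mul (by positivity), ENNReal.ofReal_coe_nnreal]
      simp only [g]
      split_ifs <;> simp
    have hsum : ∑ l ∈ Finset.range J, p l * (if U l j then x else 1) = 1 - (1 - x) * freq j := by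
      nth_rewrite 2 [← hpR]
      rw [Finset.mul_sum, ← Finset.sum_sub_distrib]
      refine Finset.sum_congr rfl fun l _ => ?_
      split_ifs <;> ring
    have hc0 := c.2.1
    have hc1 := c.2.2
    have hfreq : freq j ≤ 1 := by
      rw [← hpR]
      exact Finset.sum_le_sum fun l _ => by split_ifs <;> simp
    have hlin : ∫⁻ e, ∑ l ∈ Finset.range J, p l * g j l e ∂bernoulliMeasure false true c =
        ENNReal.ofReal (c * (1 - (1 - x) * freq j) + (1 - c)) := by
      simp_rw [hval]
      have hnn : 0 ≤ 1 - (1 - x) * freq j := by nlinarith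
      rw [lintegral_bernoulliMeasure, ENNReal.ofReal_add (mul_nonneg hc0 hnn) (by linarith),
        ENNReal.ofReal_mul hc0]
      simp only [true_and, hsum, reduceCtorEq, false_and, if_false, mul_one, hpR,
        ENNReal.ofReal_one]
    rw [hlin]
    refine ENNReal.ofReal_le_ofReal (le_trans (le_of_eq ?_) (Real.add_one_le_exp _))
    ring
  refine (Finset.prod_le_prod' fun j _ => h3 j).trans ?_
  rw [← ENNReal.ofReal_prod_of_nonneg fun _ _ => (Real.exp_pos _).le, ← Real.exp_sum,
    ← Finset.mul_sum, ← Finset.mul_sum]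
  refine ENNReal.ofReal_le_ofReal (Real.exp_le_exp.2 (mul_le_mul_of_nonpos_left ?_ (by linarith)))
  have h4 : ∑ j ∈ Finset.range N, freq j = ∑ l ∈ Finset.range J,
      (p l : ℝ) * ((Finset.range N).filter fun j => U l j).card := by
    rw [Finset.sum_comm]
    refine Finset.sum_congr rfl fun l _ => ?_
    rw [← Finset.sum_filter, Finset.sum_const, nsmul_eq_mul, mul_comm]
  have h5 : (∑ l ∈ (Finset.range J).filter fun l => ρ ≤ s l, (p l : ℝ) / s l) * ((n : ℝ) - b - 1) - 1
      ≤ ∑ j ∈ Finset.range N, freq j := by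
    rw [h4]
    calc (∑ l ∈ (Finset.range J).filter fun l => ρ ≤ s l, (p l : ℝ) / s l) * ((n : ℝ) - b - 1) - 1
        ≤ (∑ l ∈ (Finset.range J).filter fun l => ρ ≤ s l, (p l : ℝ) / s l) * ((n : ℝ) - b - 1) -
          ∑ l ∈ (Finset.range J).filter fun l => ρ ≤ s l, (p l : ℝ) := by
          refine sub_le_sub_left ?_ _
          rw [← hpR]
          exact Finset.sum_le_sum_of_subset_of_nonneg (Finset.filter_subset _ _)
            fun _ _ _ => NNReal.coe_nonneg _
      _ = ∑ l ∈ (Finset.range J).filter fun l => ρ ≤ s l,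
          (p l : ℝ) * (((n : ℝ) - b - 1) / s l - 1) := by
          rw [Finset.sum_mul, ← Finset.sum_sub_distrib]
          exact Finset.sum_congr rfl fun l _ => by ring
      _ ≤ ∑ l ∈ (Finset.range J).filter fun l => ρ ≤ s l,
          (p l : ℝ) * ((Finset.range N).filter fun j => U l j).card := by
          refine Finset.sum_le_sum fun l hl => mul_le_mul_of_nonneg_left ?_ (NNReal.coe_nonneg _)
          exact le_card_prefixLength (by exact_mod_cast hρ)
            (by exact_mod_cast (Finset.mem_filter.1 hl).2) hn
      _ ≤ _ := Finset.sum_le_sum_of_subset_of_nonneg (Finset.filter_subset _ _)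
          fun _ _ _ => by positivity
  have hc0 := c.2.1
  have hc1 := c.2.2
  nlinarith

end LayeredCode

/-! ### Achievability -/

section LayeredCode

/-- The sum is over the first index `b` in which a wrong message may differ from the transmitted
one; `x` is a free Chernoff parameter. -/
lemma bitErrorProb_layeredCode_le (p s : ℕ → ℝ≥0) (J : ℕ) (hp : ∑ l ∈ Finset.range J, p l = 1)
    (c : I) {ρ : ℝ≥0} (hρ : 0 < ρ) {x : ℝ} (hx : 1 / 2 ≤ x) (hx1 : x ≤ 1) {N n m i : ℕ}
    (hn : (n : ℝ) ≤ ρ * N) (him : i < m) :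
    (layeredCode.{u} p s J hp).bitErrorProb c N i ≤ ∑ b ∈ Finset.range m, x⁻¹ ^ (n - b) *
      Real.exp (-(1 - x) * ((c * ∑ l ∈ (Finset.range J).filter fun l => ρ ≤ s l,
        (p l : ℝ) / s l) * ((n : ℝ) - b - 1) - 1)) := by
  have := isProbabilityMeasure_layerLaw hp
  have hx0 : 0 < x := by linarith
  have hmeasLev : ∀ E b, Measurable fun lev : ℕ → ℕ =>
      ENNReal.ofReal x ^ (usefulTimes s lev E N n b).card := by
    intro E b
    simp_rw [← Finset.prod_const, usefulTimes, Finset.prod_filter]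
    exact Finset.measurable_prod _ fun j _ => (measurable_of_countable fun l : ℕ =>
      if E j = false ∧ b < prefixLength s l j ∧ prefixLength s l j ≤ n then ENNReal.ofReal x
      else 1).comp (measurable_pi_apply j)
  have hcongr : ∀ (b : ℕ) (E E' : ℕ → Bool), (∀ k < N, E k = E' k) → ∀ lev,
      usefulTimes s lev E N n b = usefulTimes s lev E' N n b := by
    intro b E E' h lev
    refine Finset.filter_congr fun j hj => ?_
    rw [h j (Finset.mem_range.1 hj)]
  have hmeasE : ∀ b, Measurable fun E : ℕ → Bool =>
      ∫⁻ lev, ENNReal.ofReal x ^ (usefulTimes s lev E N n b).card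
        ∂(Measure.infinitePi fun _ : ℕ => layerLaw p J) := fun b =>
    measurable_of_dependsOn_lt N fun E E' h => by simp_rw [hcongr b E E' h]
  have hlev : ∀ E : ℕ → Bool, ∫⁻ lev, ∑ b ∈ Finset.range m, ENNReal.ofReal (x⁻¹ ^ (n - b)) *
      ENNReal.ofReal x ^ (usefulTimes s lev E N n b).card
        ∂(Measure.infinitePi fun _ : ℕ => layerLaw p J) =
      ∑ b ∈ Finset.range m, ENNReal.ofReal (x⁻¹ ^ (n - b)) *
        ∫⁻ lev, ENNReal.ofReal x ^ (usefulTimes s lev E N n b).card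
          ∂(Measure.infinitePi fun _ : ℕ => layerLaw p J) := by
    intro E
    rw [lintegral_finsetSum _ fun b _ => (hmeasLev E b).const_mul _]
    exact Finset.sum_congr rfl fun b _ => lintegral_const_mul _ (hmeasLev E b)
  have h := jointLaw_layeredCode_le.{u} p s J hp c N i
    (fun lev E => ∑ b ∈ Finset.range m, ENNReal.ofReal (x⁻¹ ^ (n - b)) *
      ENNReal.ofReal x ^ (usefulTimes s lev E N n b).card)
    (fun lev M E => (measure_exists_consistent_le s lev M E him).trans
      (Finset.sum_le_sum fun b _ => min_one_le_mul_pow hx hx1 _ _))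
    (by
      simp_rw [hlev]
      exact Finset.measurable_sum _ fun b _ => (hmeasE b).const_mul _)
  unfold Code.bitErrorProb
  refine ENNReal.toReal_le_of_le_ofReal (Finset.sum_nonneg fun b _ => by positivity) (h.trans ?_)
  simp_rw [hlev]
  rw [lintegral_finsetSum _ fun b _ => (hmeasE b).const_mul _,
    ENNReal.ofReal_sum_of_nonneg fun b _ => by positivity]
  refine Finset.sum_le_sum fun b _ => ?_
  rw [lintegral_const_mul _ (hmeasE b), ENNReal.ofReal_mul (by positivity)]
  gcongr
  exact lintegral_pow_card_usefulTimes_le p s J hp c hρ hx0.le hx1 hn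

/-- The layered code decodes rate `ρ` at capacity `c` as soon as the layers of rate at least `ρ`
supply more than one received equation per message bit. -/
theorem admissiblePair_layeredCode (p s : ℕ → ℝ≥0) (J : ℕ) (hp : ∑ l ∈ Finset.range J, p l = 1)
    (c : I) {ρ : ℝ≥0} (hρ : 0 < ρ) {ε : ℝ} (hε : 0 < ε)
    (hc : 1 < c * ∑ l ∈ (Finset.range J).filter fun l => ρ ≤ s l, (p l : ℝ) / s l) :
    (layeredCode.{u} p s J hp).AdmissiblePair ε ρ c := by
  set θ : ℝ := c * ∑ l ∈ (Finset.range J).filter fun l => ρ ≤ s l, (p l : ℝ) / s l with hθ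
  obtain ⟨x, hx, hxθ, hx1⟩ : ∃ x : ℝ, 1 / 2 ≤ x ∧ 1 < x * θ ∧ x < 1 := by
    refine ⟨max (1 / 2) ((1 + θ⁻¹) / 2), le_max_left _ _, ?_, ?_⟩
    · have : 1 < (1 + θ⁻¹) / 2 * θ := by field_simp; linarith
      exact this.trans_le (mul_le_mul_of_nonneg_right (le_max_right _ _) (by linarith))
    · have : θ⁻¹ < 1 := inv_lt_one_of_one_lt₀ hc
      exact max_lt (by norm_num) (by linarith)
  have hx0 : 0 < x := by linarith
  -- Each additional undetermined bit costs a factor `y < 1`.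
  set y : ℝ := x⁻¹ * Real.exp (-(1 - x) * θ) with hy
  have hy0 : 0 < y := by positivity
  have hy1 : y < 1 := by
    have h1 : x⁻¹ ≤ Real.exp (x⁻¹ - 1) := by linarith [Real.add_one_le_exp (x⁻¹ - 1)]
    have h2 : x⁻¹ - 1 < (1 - x) * θ := by
      rw [show x⁻¹ - 1 = (1 - x) / x by field_simp, div_lt_iff₀ hx0]
      nlinarith
    calc y ≤ Real.exp (x⁻¹ - 1) * Real.exp (-(1 - x) * θ) :=
          mul_le_mul_of_nonneg_right h1 (Real.exp_pos _).le
      _ = Real.exp (x⁻¹ - 1 + -(1 - x) * θ) := (Real.exp_add _ _).symm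
      _ < 1 := (Real.exp_lt_exp.2 (by linarith)).trans_eq Real.exp_zero
  set D : ℝ := Real.exp ((1 - x) * (θ + 1)) with hD
  have hlim : Filter.Tendsto (fun N : ℕ => (ρ * D) * ((N : ℝ) * (y ^ ε) ^ N))
      Filter.atTop (𝓝 0) := by
    simpa using (tendsto_self_mul_const_pow_of_lt_one (Real.rpow_nonneg hy0.le ε)
      (Real.rpow_lt_one hy0.le hy1 hε)).const_mul (ρ * D : ℝ)
  obtain ⟨N₀, hN₀⟩ := Filter.eventually_atTop.1 (hlim.eventually_le_const hε)
  refine ⟨N₀, fun N hN m hm hmN => le_trans ?_ (hN₀ N hN)⟩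
  have hρ' : (0 : ℝ) < ρ := by exact_mod_cast hρ
  set n : ℕ := ⌊(ρ : ℝ) * N⌋₊ with hn
  have hn1 : (n : ℝ) ≤ ρ * N := Nat.floor_le (by positivity)
  have hn2 : (ρ : ℝ) * N < n + 1 := Nat.lt_floor_add_one _
  have hmn : m ≤ n := Nat.le_floor (by nlinarith [Nat.cast_nonneg (α := ℝ) N])
  refine (bitErrorProb_layeredCode_le.{u} p s J hp c hρ hx hx1.le hn1 (i := m - 1) (m := m)
    (by omega)).trans ?_
  rw [← hθ]
  have hterm : ∀ b ∈ Finset.range m, x⁻¹ ^ (n - b) *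
      Real.exp (-(1 - x) * (θ * ((n : ℝ) - b - 1) - 1)) ≤ (y ^ ε) ^ N * D := by
    intro b hb
    have hbm := Finset.mem_range.1 hb
    have hbn : ((n - b : ℕ) : ℝ) = (n : ℝ) - b := Nat.cast_sub (by omega)
    have hb' : (b : ℝ) + 1 ≤ m := by exact_mod_cast hbm
    calc x⁻¹ ^ (n - b) * Real.exp (-(1 - x) * (θ * ((n : ℝ) - b - 1) - 1))
        = y ^ (n - b) * D := by
          rw [hy, mul_pow, ← Real.exp_nat_mul, mul_assoc (x⁻¹ ^ (n - b)), hD, ← Real.exp_add, hbn]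
          congr 2
          ring
      _ ≤ (y ^ ε) ^ N * D := by
          refine mul_le_mul_of_nonneg_right ?_ (Real.exp_pos _).le
          rw [← Real.rpow_natCast, ← Real.rpow_natCast, ← Real.rpow_mul hy0.le]
          refine Real.rpow_le_rpow_of_exponent_ge hy0 hy1.le ?_
          rw [hbn]
          linarith
  refine (Finset.sum_le_card_nsmul _ _ _ hterm).trans ?_
  rw [Finset.card_range, nsmul_eq_mul]
  have : (m : ℝ) ≤ ρ * N := (Nat.cast_le.2 hmn).trans hn1
  calc (m : ℝ) * ((y ^ ε) ^ N * D) ≤ (ρ * N) * ((y ^ ε) ^ N * D) :=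
        mul_le_mul_of_nonneg_right this (by positivity)
    _ = _ := by ring

end LayeredCode

namespace RateCapacityFunction

/-- Summation by parts. -/
lemma sum_mul_eq_sum_sum_mul_sub (R w : ℕ → ℝ) (J : ℕ) :
    ∑ l ∈ Finset.range J, R l * w l =
      (∑ l ∈ Finset.range J, (∑ k ∈ Finset.range (l + 1), w k) * (R l - R (l + 1))) +
        (∑ k ∈ Finset.range J, w k) * R J := by
  induction J with
  | zero => simp
  | succ J ih =>
    rw [Finset.sum_range_succ, ih, Finset.sum_range_succ _ J, Finset.sum_range_succ w J]
    ring

lemma achievable_of_le_one (r : RateCapacityFunction) (hr : r.inverseCapacityIntegral ≤ 1) :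
    Achievable.{u} r := by
  intro ε hε
  -- The ratio `b` of the geometric grid: rounding the rate costs at most `ε / 2`.
  obtain ⟨b, hb0, hb1, hbε⟩ : ∃ b : ℝ, 0 < b ∧ b < 1 ∧ (1 - b ^ 2) * r 1 ≤ ε / 2 := by
    have hlim : Filter.Tendsto (fun b : ℝ => (1 - b ^ 2) * (r 1 : ℝ)) (𝓝[<] 1) (𝓝 0) := by
      have : ContinuousAt (fun b : ℝ => (1 - b ^ 2) * (r 1 : ℝ)) 1 := by fun_prop
      simpa using this.tendsto.mono_left nhdsWithin_le_nhds
    have h0 : ∀ᶠ b : ℝ in 𝓝[<] 1, 0 < b := nhdsWithin_le_nhds (Ioi_mem_nhds zero_lt_one)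
    have h1 : ∀ᶠ b : ℝ in 𝓝[<] 1, b < 1 := self_mem_nhdsWithin
    obtain ⟨b, h1, h2, h3⟩ := ((hlim.eventually_le_const (half_pos hε)).and (h1.and h0)).exists
    exact ⟨b, h3, h2, h1⟩
  set β : I := ⟨b, hb0.le, hb1.le⟩ with hβ
  obtain ⟨J, hJ⟩ := r.exists_pow_eq_zero (β := β) hb1
  have hanti : ∀ {i j : ℕ}, i ≤ j → r (β ^ j) ≤ r (β ^ i) := fun h =>
    r.monotone' (pow_le_pow_right_of_le_one' (a := β) β.2.2 h)
  set R : ℕ → ℝ := fun j => r (β ^ j) with hR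
  have hRJ : R J = 0 := by simp [hR, hJ]
  -- `w j` is the increment of the inverse capacity from layer `j - 1` to layer `j`.
  let w : ℕ → ℝ≥0 := fun j =>
    if j = 0 then b⁻¹.toNNReal else ((b ^ (j + 1))⁻¹ - (b ^ j)⁻¹).toNNReal
  have hw : ∀ j, ∑ l ∈ Finset.range (j + 1), (w l : ℝ) = (b ^ (j + 1))⁻¹ := by
    intro j
    induction j with
    | zero => simp [w, hb0.le]
    | succ j ih =>
      have hle : (b ^ (j + 1))⁻¹ ≤ (b ^ (j + 1 + 1))⁻¹ :=
        inv_anti₀ (by positivity) (pow_le_pow_of_le_one hb0.le hb1.le (Nat.le_succ _))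
      rw [Finset.sum_range_succ, ih]
      simp only [w, Nat.succ_ne_zero, if_false]
      rw [Real.coe_toNNReal _ (sub_nonneg.2 hle)]
      ring
  let s : ℕ → ℝ≥0 := fun j => (b ^ 2).toNNReal * r (β ^ j)
  have hs : ∀ j, (s j : ℝ) = b ^ 2 * R j := by
    intro j
    simp only [s, NNReal.coe_mul, Real.coe_toNNReal _ (sq_nonneg b), hR]
  have hsum : ∑ l ∈ Finset.range J, (s l * w l : ℝ) ≤ 1 := by
    have hS : ∑ j ∈ Finset.range J, ((β ^ j : I) : ℝ)⁻¹ * (R j - R (j + 1)) ≤ 1 := by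
      have := (r.le_lintegral_Ioc_pow (β := β) hb0 J).trans
        ((r.inverseCapacityIntegral_eq hJ).symm.trans_le hr)
      exact ENNReal.ofReal_le_one.1 this
    have h1 : ∑ l ∈ Finset.range J, (s l * w l : ℝ) =
        b * ∑ j ∈ Finset.range J, ((β ^ j : I) : ℝ)⁻¹ * (R j - R (j + 1)) := by
      simp_rw [hs, mul_assoc]
      rw [← Finset.mul_sum, sum_mul_eq_sum_sum_mul_sub, hRJ, mul_zero, add_zero, Finset.mul_sum,
        Finset.mul_sum]
      refine Finset.sum_congr rfl fun l _ => ?_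
      rw [hw, Set.Icc.coe_pow]
      change b ^ 2 * ((b ^ (l + 1))⁻¹ * (R l - R (l + 1))) = b * ((b ^ l)⁻¹ * (R l - R (l + 1)))
      field_simp
      ring
    rw [h1]
    nlinarith
  have hsum' : ∑ l ∈ Finset.range J, s l * w l ≤ 1 := by exact_mod_cast hsum
  -- The probability that is not needed goes to layer `J`, whose rate is zero.
  let p : ℕ → ℝ≥0 := fun j => if j < J then s j * w j else 1 - ∑ l ∈ Finset.range J, s l * w l
  have hp : ∑ l ∈ Finset.range (J + 1), p l = 1 := by
    rw [Finset.sum_range_succ]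
    have h1 : ∑ l ∈ Finset.range J, p l = ∑ l ∈ Finset.range J, s l * w l :=
      Finset.sum_congr rfl fun l hl => by simp [p, Finset.mem_range.1 hl]
    rw [h1]
    simp only [p, lt_irrefl, if_false]
    exact add_tsub_cancel_of_le hsum'
  refine ⟨layeredCode.{u} p s (J + 1) hp, fun c => ?_⟩
  rcases le_or_gt (r c : ℝ) ε with hrc | hrc
  · refine ⟨0, fun N _ m hm hmN => ?_⟩
    have h1 : (1 : ℝ) ≤ m := by exact_mod_cast hm
    have h2 : (N : ℝ) * ((r c : ℝ) - ε) ≤ 0 :=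
      mul_nonpos_of_nonneg_of_nonpos (Nat.cast_nonneg N) (by linarith)
    linarith
  have hc0 : (0 : ℝ) < c := by
    refine lt_of_le_of_ne c.2.1 fun h => ?_
    have h1 : r c ≤ r (β ^ J) := r.monotone' (by
      rw [show c = 0 from Subtype.ext h.symm]; exact (β ^ J).2.1)
    rw [hJ] at h1
    have : (r c : ℝ) ≤ 0 := by exact_mod_cast h1
    linarith
  obtain ⟨j, hj1, hj2⟩ := exists_nat_pow_near_of_lt_one hc0 c.2.2 hb0 hb1
  have hRc : (r c : ℝ) ≤ R j := by
    have : r c ≤ r (β ^ j) := r.monotone' (show (c : ℝ) ≤ (β ^ j : I) by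
      rw [Set.Icc.coe_pow]; exact hj2)
    exact_mod_cast this
  have hRpos : 0 < R j := by linarith
  have hjJ : j < J := by
    by_contra h
    have h1 := hanti (not_lt.1 h)
    rw [hJ] at h1
    have : R j ≤ 0 := by exact_mod_cast h1
    linarith
  have hspos : 0 < s j := by
    have : (0 : ℝ) < s j := by rw [hs]; positivity
    exact_mod_cast this
  have hcap : 1 < (c : ℝ) * ∑ l ∈ (Finset.range (J + 1)).filter fun l => s j ≤ s l,
      (p l : ℝ) / s l := by
    have h1 : ∑ l ∈ Finset.range (j + 1), (w l : ℝ) ≤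
        ∑ l ∈ (Finset.range (J + 1)).filter fun l => s j ≤ s l, (p l : ℝ) / s l := by
      have hmono : ∀ l ∈ Finset.range (j + 1), s j ≤ s l := fun l hl =>
        mul_le_mul_of_nonneg_left (hanti (Nat.lt_succ_iff.1 (Finset.mem_range.1 hl))) zero_le
      refine le_trans (le_of_eq ?_) (Finset.sum_le_sum_of_subset_of_nonneg
        (s := Finset.range (j + 1)) ?_ fun _ _ _ => by positivity)
      · refine Finset.sum_congr rfl fun l hl => ?_
        have hlJ : l < J := by have := Finset.mem_range.1 hl; omega
        have hsl : (s l : ℝ) ≠ 0 := by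
          exact_mod_cast (hspos.trans_le (hmono l hl)).ne'
        simp only [p, hlJ, if_true, NNReal.coe_mul]
        field_simp
      · intro l hl
        refine Finset.mem_filter.2 ⟨Finset.mem_range.2 ?_, hmono l hl⟩
        have := Finset.mem_range.1 hl
        omega
    rw [hw] at h1
    have hbj : 0 < b ^ (j + 1) := by positivity
    calc (1 : ℝ) < c * (b ^ (j + 1))⁻¹ := by rwa [← div_eq_mul_inv, one_lt_div hbj]
      _ ≤ _ := mul_le_mul_of_nonneg_left h1 hc0.le
  obtain ⟨N₀, hN₀⟩ := admissiblePair_layeredCode.{u} p s (J + 1) hp c hspos (half_pos hε) hcap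
  refine ⟨N₀, fun N hN m hm hmN => (hN₀ N hN m hm (hmN.trans ?_)).trans (half_le_self hε.le)⟩
  refine mul_le_mul_of_nonneg_left ?_ (Nat.cast_nonneg N)
  have hR1 : R j ≤ r 1 := by exact_mod_cast r.monotone' (β ^ j).2.2
  have : (1 - b ^ 2) * R j ≤ (1 - b ^ 2) * r 1 :=
    mul_le_mul_of_nonneg_left hR1 (by nlinarith)
  rw [hs]
  linarith

end RateCapacityFunction

end MRS

theorem mainTheorem1 (r : MRS.RateCapacityFunction) :
    MRS.RateCapacityFunction.Achievable.{u} r ↔ r.inverseCapacityIntegral ≤ 1 :=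
  ⟨fun h => h.inverseCapacityIntegral_le_one, r.achievable_of_le_one⟩
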